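/- **Theorem (Sectional curvature).** Let $F\hookrightarrow M\to B$ be a smooth fiber bundle with $M$ compact and compact structure group $G$ (a Lie group acting smoothly on $F$), let $\mathcal P\to B$ be the principal $G$-bundle with the same transition functions, with its principal action written on the left, and let $\bar\pi:\mathcal P\times F\to M$ be the projection onto the quotient by the action $r(p,f)=(rp,rf)$. Let $Q$ be a biinvariant metric on $G$, with Lie algebra $\mathfrak g$. Let $g$ and $g_F$ be $G$-invariant Riemannian metrics on $\mathcal P$ and $F$, and let $h$ be the metric on $M$ for which $\bar\pi:(\mathcal P\times F,g\times g_F)\to(M,h)$ is a Riemannian submersion. For $t>0$ let $g_t$ be the Cheeger deformation of $g$, i.e. the metric on $\mathcal P$ for which $(\mathcal P\times G,\,g\times\frac1tQ)\to(\mathcal P,g_t)$, $(p,a)\mapsto ap$, is a Riemannian submersion; put $g_0=g$. For $t\ge 0$ let $h_t$ be the metric on $M$ for which $\bar\pi:(\mathcal P\times F,g_t\times g_F)\to(M,h_t)$ is a Riemannian submersion. Fix $t\ge0$ and $(p,f)\in\mathcal P\times F$. For $U\in\mathfrak g$ let $U^\vee\in T_p\mathcal P$ and $U^*\in T_fF$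 be the values of the action fields of $U$, let $\mathfrak g_f=\{U: U^*=0\}$, and let $\mathfrak m_f$ be the $Q$-orthogonal complement of $\mathfrak g_f$ in $\mathfrak g$. Define $P,P_t,P_F:\mathfrak g\to\mathfrak g$ by $Q(PU,V)=g(U^\vee,V^\vee)$, $Q(P_tU,V)=g_t(U^\vee,V^\vee)$, $Q(P_FU,V)=g_F(U^*,V^*)$ for all $U,V\in\mathfrak g$. Then $P$ and $P_t$ are invertible, and $P_F$ restricts to an isomorphism $\mathfrak m_f\to\mathfrak m_f$, whose inverse is denoted by $P_F^{-1}$. Let $C_t:T_p\mathcal P\to T_p\mathcal P$ be defined by $g_t(\cdot,\cdot)=g(C_t\cdot,\cdot)$, and put $\tilde P_t=P_F(1+P_t^{-1}P_F)^{-1}$ and $\tilde C_t=-P^{-1}\tilde P_t$. For $X\in T_p\mathcal P$ and $X_F\in T_fF$ orthogonal to the $G$-orbits with respect to $g$ and $g_F$, and for $U\in\mathfrak g$, write $X+X_F+U^*:=d\bar\pi_{(p,f)}(X,X_F+U^*)$. For a metric $k$ write $K_k(X,Y)=R_k(X,Y,Y,X)$ for the unreduced sectional curvature, and put $\kappa_t(\overline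 X,\overline Y)=K_{g_t}(C_t^{-1}\overline X,C_t^{-1}\overline Y)$. Then: 1. every vector of $T_{\bar\pi(p,f)}M$ can be written in exactly one way as $X+X_F+U^*$ with $X$, $X_F$ orthogonal to the orbits and $U\in\mathfrak g$ such that $PU\in\mathfrak m_f$; 2. there is exactly one linear automorphism of $T_{\bar\pi(p,f)}M$, again denoted by $\tilde C_t$, such that $\tilde C_t(X+X_F+U^*)=X+X_F+(\tilde C_tU)^*$ for all $X$, $X_F$ orthogonal to the orbits and all $U\in\mathfrak m_f$; 3. there is a function $\tilde z_t\ge 0$ on $T_{\bar\pi(p,f)}M\times T_{\bar\pi(p,f)}M$ such that for all $\tilde X=X+X_F+U^*$ and $\tilde Y=Y+Y_F+V^*$ written as in 1, the reparametrized curvature $\tilde\kappa_t(\tilde X,\tilde Y)=K_{h_t}(\tilde C_t^{-1}\tilde X,\tilde C_t^{-1}\tilde Y)$ satisfies $$\tilde\kappa_t(\tilde X,\tilde Y)=\kappa_t(X+U^\vee,Y+V^\vee)+K_{g_F}\bigl(X_F-(P_F^{-1}PU)^*,\,Y_F-(P_F^{-1}PV)^*\bigr)+\tilde z_t(\tilde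 X,\tilde Y).$$ -/

import Mathlib

open Bundle
open scoped Manifold ContDiff

noncomputable section

namespace CheegerBundle

/-! ## Riemannian metrics and their curvature

All manifolds are smooth, finite dimensional and without boundary: they are modelled on a finite
dimensional real normed space `E` through the model `𝓘(ℝ, E)`. -/

/-- Smooth Riemannian metrics on `M`. -/
abbrev SmoothMetric (E : Type*) [NormedAddCommGroup E] [NormedSpace ℝ E]
    (M : Type*) [TopologicalSpace M] [ChartedSpace E M] [IsManifold 𝓘(ℝ, E) ∞ M] :=
  ContMDiffRiemannianMetric 𝓘(ℝ, E) ∞ E (fun x : M => TangentSpace 𝓘(ℝ, E) x)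

/-- The pullback `(u, v) ↦ b (A u) (A v)` of a bilinear form `b` by a linear map `A`. -/
def pullbackForm {V W : Type*}
    [TopologicalSpace V] [AddCommGroup V] [Module ℝ V]
    [TopologicalSpace W] [AddCommGroup W] [Module ℝ W]
    (b : V →L[ℝ] V →L[ℝ] ℝ) (A : W →L[ℝ] V) : W →L[ℝ] W →L[ℝ] ℝ :=
  (ContinuousLinearMap.precomp ℝ A).comp (b.comp A)

section Coordinates

variable {E : Type*} [NormedAddCommGroup E] [NormedSpace ℝ E]

/-- The Christoffel symbols `Γ(u, v)` at `y` of a metric `k` on an open subset of `E`: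
`2 k(Γ(u, v), w) = (∂_u k)(v, w) + (∂_v k)(u, w) - (∂_w k)(u, v)` for all `w`. -/
def christoffel (k : E → E →L[ℝ] E →L[ℝ] ℝ) (y u v : E) : E :=
  (k y).inverse ((1 / 2 : ℝ) •
    (fderiv ℝ k y u v + fderiv ℝ k y v u - ((fderiv ℝ k y).flip u).flip v))

/-- The curvature operator `R(u, v) w = ∇_u ∇_v w - ∇_v ∇_u w` at `y` (for constant coordinate
fields `u, v, w`) of a metric `k` on an open subset of `E`. -/
def coordCurvature (k : E → E →L[ℝ] E →L[ℝ] ℝ) (y u v w : E) : E :=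
  fderiv ℝ (fun x => christoffel k x v w) y u - fderiv ℝ (fun x => christoffel k x u w) y v
    + christoffel k y u (christoffel k y v w) - christoffel k y v (christoffel k y u w)

end Coordinates

section Curvature

variable {E : Type*} [NormedAddCommGroup E] [NormedSpace ℝ E]
  {M : Type*} [TopologicalSpace M] [ChartedSpace E M] [IsManifold 𝓘(ℝ, E) ∞ M]

/-- The expression of the metric `g` in the preferred chart at `x`. -/
def metricInChart (g : SmoothMetric E M) (x : M) (y : E) : E →L[ℝ] E →L[ℝ] ℝ :=
  pullbackForm (W := TangentSpace 𝓘(ℝ, E) y) (g.inner ((extChartAt 𝓘(ℝ, E) x).symm y))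
    (mfderiv 𝓘(ℝ, E) 𝓘(ℝ, E) (extChartAt 𝓘(ℝ, E) x).symm y)

/-- The Riemann curvature tensor `R_g(X, Y, Z, W) = g(R(X, Y) Z, W)` of `g` at `x`, computed in
the preferred chart at `x`; the sign is such that `R_g(X, Y, Y, X) > 0` on round spheres. -/
def riemann (g : SmoothMetric E M) (x : M) (X Y Z W : TangentSpace 𝓘(ℝ, E) x) : ℝ :=
  let dφ : TangentSpace 𝓘(ℝ, E) x →L[ℝ] E := mfderiv 𝓘(ℝ, E) 𝓘(ℝ, E) (extChartAt 𝓘(ℝ, E) x) x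
  let y : E := extChartAt 𝓘(ℝ, E) x x
  metricInChart g x y (coordCurvature (metricInChart g x) y (dφ X) (dφ Y) (dφ Z)) (dφ W)

/-- The unreduced sectional curvature `K_g(X, Y) = R_g(X, Y, Y, X)`. -/
def sec (g : SmoothMetric E M) (x : M) (X Y : TangentSpace 𝓘(ℝ, E) x) : ℝ :=
  riemann g x X Y Y X

/-- The metric tensor `C` of `g'` relative to `g` at `x`: `g'(X, Y) = g(C X, Y)`. -/
def metricTensor (g g' : SmoothMetric E M) (x : M) :
    TangentSpace 𝓘(ℝ, E) x →L[ℝ] TangentSpace 𝓘(ℝ, E) x :=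
  (g.inner x).inverse ∘L g'.inner x

/-- The reparametrized unreduced curvature `κ(X, Y) = R_{g'}(C⁻¹ X, C⁻¹ Y, C⁻¹ Y, C⁻¹ X)`, where
`C` is the metric tensor of `g'` relative to `g`. -/
def kappa (g g' : SmoothMetric E M) (x : M) (X Y : TangentSpace 𝓘(ℝ, E) x) : ℝ :=
  riemann g' x ((metricTensor g g' x).inverse X) ((metricTensor g g' x).inverse Y)
    ((metricTensor g g' x).inverse Y) ((metricTensor g g' x).inverse X)

end Curvature

/-! ## Products and Riemannian submersions -/

section Product

variable {E₁ : Type*} [NormedAddCommGroup E₁] [NormedSpace ℝ E₁]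
  {M₁ : Type*} [TopologicalSpace M₁] [ChartedSpace E₁ M₁] [IsManifold 𝓘(ℝ, E₁) ∞ M₁]
  {E₂ : Type*} [NormedAddCommGroup E₂] [NormedSpace ℝ E₂]
  {M₂ : Type*} [TopologicalSpace M₂] [ChartedSpace E₂ M₂] [IsManifold 𝓘(ℝ, E₂) ∞ M₂]

/-- The tangent vector `(u, v)` of `M₁ × M₂` at `(p, q)`. -/
def tangentPair (p : M₁) (q : M₂) (u : TangentSpace 𝓘(ℝ, E₁) p) (v : TangentSpace 𝓘(ℝ, E₂) q) :
    TangentSpace (𝓘(ℝ, E₁).prod 𝓘(ℝ, E₂)) (p, q) :=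
  ((u, v) : E₁ × E₂)

/-- The product metric `g₁ × c g₂` on `M₁ × M₂`. -/
def prodInner (g₁ : SmoothMetric E₁ M₁) (c : ℝ) (g₂ : SmoothMetric E₂ M₂) (x : M₁ × M₂)
    (u v : TangentSpace (𝓘(ℝ, E₁).prod 𝓘(ℝ, E₂)) x) : ℝ :=
  let u' : E₁ × E₂ := u
  let v' : E₁ × E₂ := v
  g₁.inner x.1 u'.1 v'.1 + c * g₂.inner x.2 u'.2 v'.2

end Product

/-- `φ : (N, k) → (M, h)` is a Riemannian submersion: `φ` is a smooth submersion and `dφ` is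
isometric on the `k`-orthogonal complement of `ker dφ`. -/
structure IsRiemannianSubmersion {E' H' : Type*} [NormedAddCommGroup E'] [NormedSpace ℝ E']
    [TopologicalSpace H'] {J : ModelWithCorners ℝ E' H'}
    {N : Type*} [TopologicalSpace N] [ChartedSpace H' N]
    {E : Type*} [NormedAddCommGroup E] [NormedSpace ℝ E]
    {M : Type*} [TopologicalSpace M] [ChartedSpace E M] [IsManifold 𝓘(ℝ, E) ∞ M]
    (k : ∀ x : N, TangentSpace J x → TangentSpace J x → ℝ) (h : SmoothMetric E M)
    (φ : N → M) : Prop where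
  contMDiff : ContMDiff J 𝓘(ℝ, E) ∞ φ
  surjective_mfderiv : ∀ x, Function.Surjective (mfderiv J 𝓘(ℝ, E) φ x)
  isometry : ∀ (x : N) (u v : TangentSpace J x),
    (∀ w, mfderiv J 𝓘(ℝ, E) φ x w = 0 → k x u w = 0) →
    (∀ w, mfderiv J 𝓘(ℝ, E) φ x w = 0 → k x v w = 0) →
    h.inner (φ x) (mfderiv J 𝓘(ℝ, E) φ x u) (mfderiv J 𝓘(ℝ, E) φ x v) = k x u v

/-! ## Isometric actions, orbit tensors and Cheeger deformations -/

section Action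

variable {EG : Type*} [NormedAddCommGroup EG] [NormedSpace ℝ EG]
  {G : Type*} [TopologicalSpace G] [ChartedSpace EG G] [Group G] [LieGroup 𝓘(ℝ, EG) ∞ G]
  {E : Type*} [NormedAddCommGroup E] [NormedSpace ℝ E]
  {M : Type*} [TopologicalSpace M] [ChartedSpace E M] [IsManifold 𝓘(ℝ, E) ∞ M] [MulAction G M]

/-- `Q` is a biinvariant Riemannian metric on the Lie group `G`. -/
structure IsBiinvariant (Q : SmoothMetric EG G) : Prop where
  left : ∀ (r a : G) (u v : TangentSpace 𝓘(ℝ, EG) a),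
    Q.inner (r * a) (mfderiv 𝓘(ℝ, EG) 𝓘(ℝ, EG) (fun b => r * b) a u)
      (mfderiv 𝓘(ℝ, EG) 𝓘(ℝ, EG) (fun b => r * b) a v) = Q.inner a u v
  right : ∀ (r a : G) (u v : TangentSpace 𝓘(ℝ, EG) a),
    Q.inner (a * r) (mfderiv 𝓘(ℝ, EG) 𝓘(ℝ, EG) (fun b => b * r) a u)
      (mfderiv 𝓘(ℝ, EG) 𝓘(ℝ, EG) (fun b => b * r) a v) = Q.inner a u v

variable (G) in
/-- The metric `g` on `M` is invariant under the action of `G`. -/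
def IsInvariant (g : SmoothMetric E M) : Prop :=
  ∀ (r : G) (p : M) (u v : TangentSpace 𝓘(ℝ, E) p),
    g.inner (r • p) (mfderiv 𝓘(ℝ, E) 𝓘(ℝ, E) (fun q : M => r • q) p u)
      (mfderiv 𝓘(ℝ, E) 𝓘(ℝ, E) (fun q : M => r • q) p v) = g.inner p u v

/-- `gt` is the time `t` Cheeger deformation of the `G`-invariant metric `g`: for `t > 0` it is the
metric on `M` for which `(q, a) ↦ a • q` is a Riemannian submersion from
`(M × G, g × (1 / t) Q)`; at `t = 0` it is `g`. -/
def IsCheegerDeformation (Q : SmoothMetric EG G)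
    (g : SmoothMetric E M) (t : ℝ) (gt : SmoothMetric E M) : Prop :=
  (t = 0 ∧ gt = g) ∨
    (0 < t ∧ IsRiemannianSubmersion (prodInner g (1 / t) Q) gt (fun x : M × G => x.2 • x.1))

variable (EG G) in
/-- The action field map `U ↦ U^*_p = d/ds|₀ exp(sU) p`, i.e. the differential at `1` of
`a ↦ a • p`. -/
def actionField (p : M) : GroupLieAlgebra 𝓘(ℝ, EG) G →L[ℝ] TangentSpace 𝓘(ℝ, E) p :=
  mfderiv 𝓘(ℝ, EG) 𝓘(ℝ, E) (fun a : G => a • p) 1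

variable (EG G) in
/-- The `g`-orthogonal complement of the tangent space at `p` to the orbit of `p`. -/
def orbitNormal (g : SmoothMetric E M) (p : M) : Submodule ℝ (TangentSpace 𝓘(ℝ, E) p) where
  carrier := {X | ∀ U, g.inner p X (actionField EG G p U) = 0}
  add_mem' {X Y} hX hY U := by
    rw [map_add, _root_.add_apply, hX U, hY U, add_zero]
  zero_mem' U := by rw [map_zero, _root_.zero_apply]
  smul_mem' c X hX U := by
    rw [map_smul, _root_.smul_apply, hX U, smul_zero]

/-- `𝔪_p`: the `Q`-orthogonal complement in `𝔤` of the isotropy algebra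
`𝔤_p = ker (U ↦ U^*_p)`. -/
def isotropyCompl (Q : SmoothMetric EG G) (p : M) :
    Submodule ℝ (GroupLieAlgebra 𝓘(ℝ, EG) G) where
  carrier := {V | ∀ U, actionField (E := E) EG G p U = 0 → Q.inner 1 V U = 0}
  add_mem' {V W} hV hW U hU := by
    rw [map_add, _root_.add_apply, hV U hU, hW U hU, add_zero]
  zero_mem' U _ := by rw [map_zero, _root_.zero_apply]
  smul_mem' c V hV U hU := by
    rw [map_smul, _root_.smul_apply, hV U hU, smul_zero]

/-- The orbit tensor `P` of `g` at `p`, extended by zero on `𝔤_p`: the endomorphism of `𝔤` with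
`Q(P U, V) = g(U^*_p, V^*_p)` for all `U, V ∈ 𝔤`. It takes values in `𝔪_p`, and its restriction
`𝔪_p → 𝔪_p` is the orbit tensor. -/
def orbitTensor (Q : SmoothMetric EG G) (g : SmoothMetric E M) (p : M) :
    GroupLieAlgebra 𝓘(ℝ, EG) G →L[ℝ] GroupLieAlgebra 𝓘(ℝ, EG) G :=
  (Q.inner 1).inverse ∘L pullbackForm (g.inner p) (actionField EG G p)

/-- The inverse `P⁻¹ : 𝔪_p → 𝔪_p` of the orbit tensor of `g` at `p` (only meaningful on `𝔪_p`). -/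
def orbitTensorInv (Q : SmoothMetric EG G) (g : SmoothMetric E M)
    (p : M) : GroupLieAlgebra 𝓘(ℝ, EG) G → GroupLieAlgebra 𝓘(ℝ, EG) G :=
  Function.invFunOn (orbitTensor Q g p) (isotropyCompl (E := E) Q p)

end Action

/-! ## Fiber bundles with structure group `G` -/

section Bundles

variable (EG : Type*) [NormedAddCommGroup EG] [NormedSpace ℝ EG]
  (G : Type*) [TopologicalSpace G] [ChartedSpace EG G] [Group G]
  (EF : Type*) [NormedAddCommGroup EF] [NormedSpace ℝ EF]
  (F : Type*) [TopologicalSpace F] [ChartedSpace EF F] [MulAction G F]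
  (EB : Type*) [NormedAddCommGroup EB] [NormedSpace ℝ EB]
  {B : Type*} [TopologicalSpace B] [ChartedSpace EB B]
  (EM : Type*) [NormedAddCommGroup EM] [NormedSpace ℝ EM]
  {M : Type*} [TopologicalSpace M] [ChartedSpace EM M]
  (EP : Type*) [NormedAddCommGroup EP] [NormedSpace ℝ EP]
  {P : Type*} [TopologicalSpace P] [ChartedSpace EP P] [MulAction G P]

/-- A smooth fiber bundle `proj : M → B` with fiber `F` and structure group `G`: a covering family of
smooth local trivializations `φ_i : proj⁻¹(U_i) → U_i × F` together with transition functions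
`φ_ij : U_i ∩ U_j → G` such that `φ_i ∘ φ_j⁻¹ (b, f) = (b, φ_ij(b) f)`. -/
structure BundleAtlas (ι : Type*) (proj : M → B) where
  triv : ι → Trivialization F proj
  cover : ∀ b : B, ∃ i, b ∈ (triv i).baseSet
  contMDiffOn_triv : ∀ i, ContMDiffOn 𝓘(ℝ, EM) (𝓘(ℝ, EB).prod 𝓘(ℝ, EF)) ∞
    (triv i).toOpenPartialHomeomorph (triv i).source
  contMDiffOn_symm : ∀ i, ContMDiffOn (𝓘(ℝ, EB).prod 𝓘(ℝ, EF)) 𝓘(ℝ, EM) ∞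
    (triv i).toOpenPartialHomeomorph.symm (triv i).target
  transition : ι → ι → B → G
  continuousOn_transition : ∀ i j,
    ContinuousOn (transition i j) ((triv i).baseSet ∩ (triv j).baseSet)
  triv_symm : ∀ i j, ∀ b ∈ (triv i).baseSet ∩ (triv j).baseSet, ∀ f : F,
    (triv i).toOpenPartialHomeomorph ((triv j).toOpenPartialHomeomorph.symm (b, f)) =
      (b, transition i j b • f)

variable {G EF F EB EM}

/-- The smooth principal `G`-bundle `pr : P → B` built from the transition functions of a bundle
atlas `A`: it has smooth local trivializations `ψ_i : pr⁻¹(U_i) → U_i × G` over the same sets `U_i`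
and with the same transition functions, in which the (left) principal action reads
`r (b, a) = (b, a r⁻¹)`. -/
structure PrincipalBundle {ι : Type*} {proj : M → B} (A : BundleAtlas G EF F EB EM ι proj)
    (pr : P → B) where
  triv : ι → Trivialization G pr
  baseSet_eq : ∀ i, (triv i).baseSet = (A.triv i).baseSet
  contMDiffOn_triv : ∀ i, ContMDiffOn 𝓘(ℝ, EP) (𝓘(ℝ, EB).prod 𝓘(ℝ, EG)) ∞
    (triv i).toOpenPartialHomeomorph (triv i).source
  contMDiffOn_symm : ∀ i, ContMDiffOn (𝓘(ℝ, EB).prod 𝓘(ℝ, EG)) 𝓘(ℝ, EP) ∞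
    (triv i).toOpenPartialHomeomorph.symm (triv i).target
  triv_symm : ∀ i j, ∀ b ∈ (triv i).baseSet ∩ (triv j).baseSet, ∀ a : G,
    (triv i).toOpenPartialHomeomorph ((triv j).toOpenPartialHomeomorph.symm (b, a)) =
      (b, A.transition i j b * a)
  proj_smul : ∀ (r : G) (p : P), pr (r • p) = pr p
  triv_smul : ∀ (i : ι) (r : G) (p : P), pr p ∈ (triv i).baseSet →
    (triv i).toOpenPartialHomeomorph (r • p) =
      (pr p, ((triv i).toOpenPartialHomeomorph p).2 * r⁻¹)

variable {EG EP}

/-- The projection `π̄ : P × F → M`: in terms of any local trivialization over a neighbourhood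
`U_i` of `pr p`, it is `π̄(p, f) = φ_i⁻¹(pr p, ψ_i(p) f)`. Two points have the same image if and
only if they are in the same orbit of the diagonal action `r (p, f) = (r p, r f)`. -/
def assocProj {ι : Type*} {proj : M → B} {A : BundleAtlas G EF F EB EM ι proj} {pr : P → B}
    (PB : PrincipalBundle EG EP A pr) (x : P × F) : M :=
  let i : ι := (A.cover (pr x.1)).choose
  (A.triv i).toOpenPartialHomeomorph.symm
    (pr x.1, ((PB.triv i).toOpenPartialHomeomorph x.1).2 • x.2)

end Bundles

/-! ## Tensors attached to the deformation -/

section Tensors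

variable {EG : Type*} [NormedAddCommGroup EG] [NormedSpace ℝ EG]
  {G : Type*} [TopologicalSpace G] [ChartedSpace EG G] [Group G] [LieGroup 𝓘(ℝ, EG) ∞ G]
 
  {EP : Type*} [NormedAddCommGroup EP] [NormedSpace ℝ EP]
  {P : Type*} [TopologicalSpace P] [ChartedSpace EP P] [IsManifold 𝓘(ℝ, EP) ∞ P] [MulAction G P]
  {EF : Type*} [NormedAddCommGroup EF] [NormedSpace ℝ EF]
  {F : Type*} [TopologicalSpace F] [ChartedSpace EF F] [IsManifold 𝓘(ℝ, EF) ∞ F] [MulAction G F]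

/-- `P̃_t = P_F (1 + P_t⁻¹ P_F)⁻¹`, where `P_t` is the (invertible) orbit tensor of `gt` at `p` and
`P_F` the orbit tensor of `gF` at `f`. -/
def tildeP (Q : SmoothMetric EG G) (gt : SmoothMetric EP P) (gF : SmoothMetric EF F)
    (p : P) (f : F) : GroupLieAlgebra 𝓘(ℝ, EG) G →L[ℝ] GroupLieAlgebra 𝓘(ℝ, EG) G :=
  orbitTensor Q gF f ∘L
    (ContinuousLinearMap.id ℝ _ + (orbitTensor Q gt p).inverse ∘L orbitTensor Q gF f).inverse

/-- `C̃_t = - P⁻¹ P̃_t`, where `P` is the (invertible) orbit tensor of `g` at `p`. -/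
def tildeC (Q : SmoothMetric EG G) (g gt : SmoothMetric EP P) (gF : SmoothMetric EF F)
    (p : P) (f : F) : GroupLieAlgebra 𝓘(ℝ, EG) G →L[ℝ] GroupLieAlgebra 𝓘(ℝ, EG) G :=
  -((orbitTensor Q g p).inverse ∘L tildeP Q gt gF p f)

variable {EB : Type*} [NormedAddCommGroup EB] [NormedSpace ℝ EB]
  {B : Type*} [TopologicalSpace B] [ChartedSpace EB B]
  {EM : Type*} [NormedAddCommGroup EM] [NormedSpace ℝ EM]
  {M : Type*} [TopologicalSpace M] [ChartedSpace EM M]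
  {ι : Type*} {proj : M → B} {A : BundleAtlas G EF F EB EM ι proj} {pr : P → B}

/-- The tangent vector `X + X_F + U^* := dπ̄_{(p, f)}(X, X_F + U^*_f)` of `M` at `π̄(p, f)`. -/
def baseVec (PB : PrincipalBundle EG EP A pr) (p : P) (f : F) (X : TangentSpace 𝓘(ℝ, EP) p)
    (XF : TangentSpace 𝓘(ℝ, EF) f) (U : GroupLieAlgebra 𝓘(ℝ, EG) G) :
    TangentSpace 𝓘(ℝ, EM) (assocProj PB (p, f)) :=
  mfderiv (𝓘(ℝ, EP).prod 𝓘(ℝ, EF)) 𝓘(ℝ, EM) (assocProj PB) (p, f)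
    (tangentPair p f X (XF + actionField EG G f U))

/-- `C` is the extension of `C̃_t` to the tangent space of `M` at `π̄(p, f)`:
`C (X + X_F + U^*) = X + X_F + (C̃_t U)^*` for `X`, `X_F` normal to the orbits and `U ∈ 𝔪_f`. -/
def IsTildeCExtension (Q : SmoothMetric EG G) (g gt : SmoothMetric EP P) (gF : SmoothMetric EF F)
    (PB : PrincipalBundle EG EP A pr) (p : P) (f : F)
    (C : TangentSpace 𝓘(ℝ, EM) (assocProj PB (p, f)) ≃ₗ[ℝ]
      TangentSpace 𝓘(ℝ, EM) (assocProj PB (p, f))) : Prop :=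
  ∀ X ∈ orbitNormal EG G g p, ∀ XF ∈ orbitNormal EG G gF f, ∀ U ∈ isotropyCompl (E := EF) Q f,
    C (baseVec PB p f X XF U) = baseVec PB p f X XF (tildeC Q g gt gF p f U)

end Tensors

end CheegerBundle

end

noncomputable section

set_option maxSynthPendingDepth 3
set_option linter.unusedSectionVars false

namespace CheegerBundle

/-! ## Positive definite bilinear forms -/

section Forms

variable {V : Type*} [NormedAddCommGroup V] [NormedSpace ℝ V] [FiniteDimensional ℝ V]

/-! The formula is O'Neill's formula for `π̄` on `(P × F, g_t × g_F)`, evaluated on an explicit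
horizontal lift. Write `A = P_F⁻¹ P U` and `S = 1 + P_t⁻¹ P_F`. The claim is that the horizontal
lift of `C̃_t⁻¹ (X + X_F + U^*)` is `(C_t⁻¹ (X + U^∨), X_F - A^*)`.

A Cheeger deformation changes neither the normal space of an orbit nor the metric on it
(`form_eq_of_isometry_add`), so `C_t⁻¹ (X + U^∨) = X + (P_t⁻¹ P U)^∨` (`Ct_inverse`). The kernel of
`dπ̄` consists of the vectors `(B^∨, B^*)` (`exists_actionField_of_mfderiv_assocProj`). Against such
a vector the first component contributes `Q(P U, B)` and the second `-Q(P U, B)`, so the proposed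
lift is horizontal (`horizontal`). Subtracting the vertical vector of `P_t⁻¹ P U` shows that its
image is `X + X_F - (S A)^*`. Since `C̃_t S = -P⁻¹ P_F`, applying `C̃_t` to this image gives `X +
X_F + U^*` (`isExtension_symm_vec`).

The curvature of a product metric is the sum of the curvatures, and a Riemannian submersion does not
decrease the curvature of horizontal vectors (`sec_add_sec_le`). Hence the difference of the two
sides of the formula is nonnegative, and it serves as `z̃_t`. It is a well-defined function of
tangent vectors because the decomposition `X + X_F + U^*` with `P U ∈ 𝔪_f` is unique
(`existsUnique_vec`).

O'Neill's formula is itself proved in charts. The Hessian of a Riemannian submersion vanishes on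
pairs of horizontal vectors (`mapHessian_horLift`), and the vertical part of the covariant
derivative of horizontal lifts is antisymmetric (`oneillTensor_antisymm`). Expanding the curvature
on lifts of constant fields then leaves three times the square of this tensor. -/

theorem isInvertible_of_injective_of_finrank_eq {W : Type*} [NormedAddCommGroup W]
    [NormedSpace ℝ W] [FiniteDimensional ℝ W] (A : V →L[ℝ] W)
    (hA : ∀ v, A v = 0 → v = 0) (hd : Module.finrank ℝ V = Module.finrank ℝ W) :
    A.IsInvertible := by
  have hinj : Function.Injective (A : V →ₗ[ℝ] W) := by
    rw [← LinearMap.ker_eq_bot, LinearMap.ker_eq_bot']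
    exact hA
  let e := LinearEquiv.ofBijective (A : V →ₗ[ℝ] W)
    ⟨hinj, (LinearMap.injective_iff_surjective_of_finrank_eq_finrank hd).1 hinj⟩
  exact ⟨e.toContinuousLinearEquiv, by ext v; rfl⟩

theorem finrank_continuousDual : Module.finrank ℝ (V →L[ℝ] ℝ) = Module.finrank ℝ V := by
  rw [← (LinearMap.toContinuousLinearMap (𝕜 := ℝ) (E := V) (F' := ℝ)).finrank_eq]
  exact Subspace.dual_finrank_eq

/-- A positive definite form is invertible as a map to the dual. -/
theorem isInvertible_of_pos {b : V →L[ℝ] V →L[ℝ] ℝ} (hb : ∀ v, v ≠ 0 → 0 < b v v) :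
    b.IsInvertible := by
  refine isInvertible_of_injective_of_finrank_eq b (fun v hv => ?_) finrank_continuousDual.symm
  by_contra h
  have := hb v h
  rw [hv] at this
  exact lt_irrefl _ this

theorem eq_of_form_eq {b : V →L[ℝ] V →L[ℝ] ℝ} (hb : ∀ v, v ≠ 0 → 0 < b v v) {x y : V}
    (h : ∀ w, b x w = b y w) : x = y :=
  (isInvertible_of_pos hb).injective (ContinuousLinearMap.ext h)

/-- Orthogonal projection onto the range of a linear map. -/
theorem exists_sub_orthogonal_range {b : V →L[ℝ] V →L[ℝ] ℝ} 
    (hb : ∀ v, v ≠ 0 → 0 < b v v) {W : Type*} [AddCommGroup W] [Module ℝ W] (T : W →ₗ[ℝ] V)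
    (v : V) : ∃ w, ∀ w', b (v - T w) (T w') = 0 := by
  let S := LinearMap.range T
  let c : S →ₗ[ℝ] Module.Dual ℝ S :=
    { toFun := fun s => ((b s : V →L[ℝ] ℝ) : V →ₗ[ℝ] ℝ).comp S.subtype
      map_add' := fun x y => by ext z; simp
      map_smul' := fun a x => by ext z; simp }
  -- Positivity makes the restriction of `b` to the range nondegenerate. By finite dimension every
  -- functional on the range, in particular `b v`, is then represented by an element of it.
  have hc : Function.Injective c := by
    rw [← LinearMap.ker_eq_bot, LinearMap.ker_eq_bot']
    intro s hs0
    by_contra h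
    have h1 := hb (s : V) (by simpa using h)
    have h2 := LinearMap.congr_fun hs0 s
    simp only [c, LinearMap.coe_mk, AddHom.coe_mk, LinearMap.comp_apply, Submodule.subtype_apply,
      ContinuousLinearMap.coe_coe, LinearMap.zero_apply] at h2
    rw [h2] at h1
    exact lt_irrefl _ h1
  have hsurj := (LinearMap.injective_iff_surjective_of_finrank_eq_finrank
    (Subspace.dual_finrank_eq (K := ℝ) (V := S)).symm).1 hc
  obtain ⟨⟨_, w, rfl⟩, hw⟩ := hsurj (((b v : V →L[ℝ] ℝ) : V →ₗ[ℝ] ℝ).comp S.subtype)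
  refine ⟨w, fun w' => ?_⟩
  have := LinearMap.congr_fun hw ⟨T w', w', rfl⟩
  simp only [c, LinearMap.coe_mk, AddHom.coe_mk, LinearMap.comp_apply, Submodule.subtype_apply,
    ContinuousLinearMap.coe_coe] at this
  rw [map_sub, _root_.sub_apply, this, sub_self]

end Forms

/-! ## The Levi-Civita connection in coordinates -/

section Christoffel

variable {E : Type*} [NormedAddCommGroup E] [NormedSpace ℝ E]

/-- `christoffel` as a continuous bilinear map. -/
def christoffelL (k : E → E →L[ℝ] E →L[ℝ] ℝ) (y : E) : E →L[ℝ] E →L[ℝ] E :=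
  (ContinuousLinearMap.compL ℝ E (E →L[ℝ] ℝ) E (k y).inverse) ∘L ((1 / 2 : ℝ) •
    (fderiv ℝ k y + (fderiv ℝ k y).flip -
      ((ContinuousLinearMap.flipₗᵢ ℝ E E ℝ).toContinuousLinearEquiv :
        (E →L[ℝ] E →L[ℝ] ℝ) →L[ℝ] (E →L[ℝ] E →L[ℝ] ℝ)) ∘L (fderiv ℝ k y).flip))

theorem christoffelL_apply (k : E → E →L[ℝ] E →L[ℝ] ℝ) (y u v : E) :
    christoffelL k y u v = christoffel k y u v := by
  simp only [christoffelL, christoffel]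
  rfl

/-- A smooth family of positive definite symmetric forms on the set `s`. -/
structure IsMetricOn (k : E → E →L[ℝ] E →L[ℝ] ℝ) (s : Set E) : Prop where
  contDiffOn : ContDiffOn ℝ ∞ k s
  symm : ∀ x ∈ s, ∀ u v, k x u v = k x v u
  pos : ∀ x ∈ s, ∀ v, v ≠ 0 → 0 < k x v v

/-- The covariant derivative `D_z Y` at `x` of the vector field `Y`. -/
def covDeriv (k : E → E →L[ℝ] E →L[ℝ] ℝ) (Y : E → E) (x z : E) : E :=
  fderiv ℝ Y x z + christoffelL k x z (Y x)

variable {k : E → E →L[ℝ] E →L[ℝ] ℝ} {s : Set E}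

theorem IsMetricOn.contDiffAt (hk : IsMetricOn k s) (hs : IsOpen s) {x : E} (hx : x ∈ s) :
    ContDiffAt ℝ ∞ k x :=
  hk.contDiffOn.contDiffAt (hs.mem_nhds hx)

variable [FiniteDimensional ℝ E]

theorem IsMetricOn.isInvertible (hk : IsMetricOn k s) {x : E} (hx : x ∈ s) :
    (k x).IsInvertible := isInvertible_of_pos (hk.pos x hx)

theorem IsMetricOn.contDiffOn_inverse (hk : IsMetricOn k s) :
    ContDiffOn ℝ ∞ (fun x => (k x).inverse) s := fun x hx => by
  have : ContDiffAt ℝ ∞ ContinuousLinearMap.inverse (k x) :=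
    (hk.isInvertible hx).contDiffAt_map_inverse
  exact this.comp_contDiffWithinAt x (hk.contDiffOn x hx)

theorem IsMetricOn.contDiffOn_christoffelL (hk : IsMetricOn k s) (hs : IsOpen s) :
    ContDiffOn ℝ ∞ (christoffelL k) s := by
  have h1 : ContDiffOn ℝ ∞ (fderiv ℝ k) s := hk.contDiffOn.fderiv_of_isOpen hs (by simp)
  have h2 : ContDiffOn ℝ ∞ (fun x => (fderiv ℝ k x).flip) s :=
    (ContinuousLinearMap.flipₗᵢ ℝ E E (E →L[ℝ] ℝ)).contDiff.comp_contDiffOn h1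
  unfold christoffelL
  refine ContDiffOn.clm_comp ?_ ?_
  · exact (ContinuousLinearMap.compL ℝ E (E →L[ℝ] ℝ) E).contDiff.comp_contDiffOn
      hk.contDiffOn_inverse
  · exact ContDiffOn.const_smul _ ((h1.add h2).sub (contDiffOn_const.clm_comp h2))

theorem IsMetricOn.form_christoffelL (hk : IsMetricOn k s) {x : E} (hx : x ∈ s) (u v w : E) :
    k x (christoffelL k x u v) w =
      (1 / 2) * (fderiv ℝ k x u v w + fderiv ℝ k x v u w - fderiv ℝ k x w u v) := by
  rw [christoffelL_apply, christoffel, (hk.isInvertible hx).self_apply_inverse]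
  simp

theorem IsMetricOn.fderiv_symm (hk : IsMetricOn k s) (hs : IsOpen s) {x : E} (hx : x ∈ s)
    (z u v : E) : fderiv ℝ k x z u v = fderiv ℝ k x z v u := by
  have hd : DifferentiableAt ℝ k x := (hk.contDiffAt hs hx).differentiableAt (by simp)
  have key : ∀ a b : E, fderiv ℝ (fun y => k y a b) x z = fderiv ℝ k x z a b := fun a b => by
    have := (hd.hasFDerivAt.clm_apply (hasFDerivAt_const a x)).clm_apply (hasFDerivAt_const b x)
    rw [this.fderiv]; simp
  rw [← key, ← key]
  congr 1
  apply Filter.EventuallyEq.fderiv_eq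
  filter_upwards [hs.mem_nhds hx] with y hy using hk.symm y hy u v

theorem IsMetricOn.christoffelL_symm (hk : IsMetricOn k s) (hs : IsOpen s) {x : E} (hx : x ∈ s)
    (u v : E) : christoffelL k x u v = christoffelL k x v u := by
  refine eq_of_form_eq (hk.pos x hx) fun w => ?_
  rw [hk.form_christoffelL hx, hk.form_christoffelL hx, hk.fderiv_symm hs hx w u v]
  ring

/-- Metric compatibility: in the sum of the two Koszul expressions the four terms not differentiated
along `z` cancel. -/
theorem IsMetricOn.fderiv_apply (hk : IsMetricOn k s) (hs : IsOpen s) {x : E} (hx : x ∈ s)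
    (z u v : E) : fderiv ℝ k x z u v =
      k x (christoffelL k x z u) v + k x u (christoffelL k x z v) := by
  rw [hk.symm x hx u, hk.form_christoffelL hx, hk.form_christoffelL hx,
    hk.fderiv_symm hs hx z v u, hk.fderiv_symm hs hx u z v, hk.fderiv_symm hs hx v z u]
  ring

/-- The commutator of second covariant derivatives is the curvature. -/
theorem IsMetricOn.coordCurvature_eq (hk : IsMetricOn k s) (hs : IsOpen s) {X Y Z : E → E}
    (hX : ContDiffOn ℝ ∞ X s) (hY : ContDiffOn ℝ ∞ Y s) (hZ : ContDiffOn ℝ ∞ Z s)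
    {x : E} (hx : x ∈ s) :
    coordCurvature k x (X x) (Y x) (Z x) =
      covDeriv k (fun y => covDeriv k Z y (Y y)) x (X x)
        - covDeriv k (fun y => covDeriv k Z y (X y)) x (Y x)
        - covDeriv k Z x (covDeriv k Y x (X x) - covDeriv k X x (Y x)) := by
  have hΓ : HasFDerivAt (christoffelL k) (fderiv ℝ (christoffelL k) x) x :=
    (((hk.contDiffOn_christoffelL hs).contDiffAt (hs.mem_nhds hx)).differentiableAt
      (by simp)).hasFDerivAt
  have hZc : ContDiffAt ℝ ∞ Z x := hZ.contDiffAt (hs.mem_nhds hx)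
  have hZ1 : HasFDerivAt Z (fderiv ℝ Z x) x := (hZc.differentiableAt (by simp)).hasFDerivAt
  have hZ2 : HasFDerivAt (fderiv ℝ Z) (fderiv ℝ (fderiv ℝ Z) x) x :=
    ((hZc.fderiv_right (m := 1)
      (by exact WithTop.coe_le_coe.2 (le_top (a := (1 + 1 : ℕ∞))))).differentiableAt
        (by simp)).hasFDerivAt
  have hsymm : fderiv ℝ (fderiv ℝ Z) x (X x) (Y x) = fderiv ℝ (fderiv ℝ Z) x (Y x) (X x) :=
    (hZc.isSymmSndFDerivAt (by simpa using WithTop.coe_le_coe.2 (le_top (a := (2 : ℕ∞)))))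
      (X x) (Y x)
  -- Expanding the second covariant derivative leaves a second derivative of `Z`, which is symmetric
  -- and cancels on antisymmetrizing. The terms in the derivative of `W` combine into the bracket
  -- correction, written through covariant derivatives by torsion-freeness.
  have hcov : ∀ W : E → E, ContDiffOn ℝ ∞ W s → ∀ z, covDeriv k (fun y => covDeriv k Z y (W y)) x z
      = fderiv ℝ (fderiv ℝ Z) x z (W x) + fderiv ℝ Z x (fderiv ℝ W x z)
        + (fderiv ℝ (christoffelL k) x z (W x) (Z x) + christoffelL k x (fderiv ℝ W x z) (Z x)
          + christoffelL k x (W x) (fderiv ℝ Z x z))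
        + christoffelL k x z (fderiv ℝ Z x (W x) + christoffelL k x (W x) (Z x)) := by
    intro W hW z
    have hW1 : HasFDerivAt W (fderiv ℝ W x) x :=
      ((hW.contDiffAt (hs.mem_nhds hx)).differentiableAt (by simp)).hasFDerivAt
    have := (hZ2.clm_apply hW1).add ((hΓ.clm_apply hW1).clm_apply hZ1)
    have h2 : fderiv ℝ (fun y => covDeriv k Z y (W y)) x = _ := this.fderiv
    rw [covDeriv, h2]
    simp only [covDeriv, _root_.add_apply, ContinuousLinearMap.comp_apply,
      ContinuousLinearMap.flip_apply]
    abel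
  have hchr : ∀ a b z, fderiv ℝ (fun y => christoffel k y a b) x z =
      fderiv ℝ (christoffelL k) x z a b := fun a b z => by
    have := (hΓ.clm_apply (hasFDerivAt_const a x)).clm_apply (hasFDerivAt_const b x)
    simp only [christoffelL_apply] at this
    rw [this.fderiv]; simp
  rw [hcov Y hY, hcov X hX, coordCurvature, hchr, hchr, hsymm]
  simp only [covDeriv, ← christoffelL_apply, map_add, map_sub, _root_.add_apply, _root_.sub_apply,
    hk.christoffelL_symm hs hx (Y x) (X x)]
  abel

end Christoffel

/-! ## O'Neill's inequality in coordinates -/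

section ONeill

variable {N : Type*} [NormedAddCommGroup N] [NormedSpace ℝ N] [FiniteDimensional ℝ N]
  {E : Type*} [NormedAddCommGroup E] [NormedSpace ℝ E] [FiniteDimensional ℝ E]

/-- `φ : (s, k) → (t, h)` is a Riemannian submersion between open subsets of normed spaces. -/
structure IsCoordSubmersion (k : N → N →L[ℝ] N →L[ℝ] ℝ) (s : Set N)
    (h : E → E →L[ℝ] E →L[ℝ] ℝ) (t : Set E) (φ : N → E) : Prop where
  isOpen_source : IsOpen s
  isOpen_target : IsOpen t
  metric_source : IsMetricOn k s
  metric_target : IsMetricOn h t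
  mapsTo : Set.MapsTo φ s t
  contDiffOn : ContDiffOn ℝ ∞ φ s
  surjective : ∀ x ∈ s, Function.Surjective (fderiv ℝ φ x)
  isometry : ∀ x ∈ s, ∀ u v, (∀ w, fderiv ℝ φ x w = 0 → k x u w = 0) →
    (∀ w, fderiv ℝ φ x w = 0 → k x v w = 0) →
    h (φ x) (fderiv ℝ φ x u) (fderiv ℝ φ x v) = k x u v

/-- The horizontal lift `E → N` at `x`, the adjoint of `dφ`. -/
def horLift (k : N → N →L[ℝ] N →L[ℝ] ℝ) (h : E → E →L[ℝ] E →L[ℝ] ℝ) (φ : N → E) (x : N) :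
    E →L[ℝ] N :=
  (k x).inverse ∘L ((ContinuousLinearMap.compL ℝ N E ℝ).flip (fderiv ℝ φ x)) ∘L h (φ x)

/-- The second fundamental form of the map `φ`. -/
def mapHessian (k : N → N →L[ℝ] N →L[ℝ] ℝ) (h : E → E →L[ℝ] E →L[ℝ] ℝ) (φ : N → E) (x : N)
    (z w : N) : E :=
  fderiv ℝ (fderiv ℝ φ) x z w + christoffelL h (φ x) (fderiv ℝ φ x z) (fderiv ℝ φ x w)
    - fderiv ℝ φ x (christoffelL k x z w)

/-- The vertical part of the covariant derivative of one horizontal lift along another. -/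
def oneillTensor (k : N → N →L[ℝ] N →L[ℝ] ℝ) (h : E → E →L[ℝ] E →L[ℝ] ℝ)
    (φ : N → E) (x : N) (u v : E) : N :=
  covDeriv k (fun y => horLift k h φ y v) x (horLift k h φ x u)
    - horLift k h φ x (christoffelL h (φ x) u v)

namespace IsCoordSubmersion

variable {k : N → N →L[ℝ] N →L[ℝ] ℝ} {s : Set N} {h : E → E →L[ℝ] E →L[ℝ] ℝ} {t : Set E}
  {φ : N → E} {x : N}

theorem form_horLift (H : IsCoordSubmersion k s h t φ) (hx : x ∈ s) (u : E) (w : N) :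
    k x (horLift k h φ x u) w = h (φ x) u (fderiv ℝ φ x w) := by
  have := (H.metric_source.isInvertible hx).self_apply_inverse
    (((ContinuousLinearMap.compL ℝ N E ℝ).flip (fderiv ℝ φ x)) (h (φ x) u))
  exact congrArg (fun l : N →L[ℝ] ℝ => l w) this

theorem exists_horizontal (H : IsCoordSubmersion k s h t φ) (hx : x ∈ s)
    (w : N) : ∃ w', fderiv ℝ φ x w' = fderiv ℝ φ x w ∧
    ∀ v, fderiv ℝ φ x v = 0 → k x w' v = 0 := by
  obtain ⟨⟨v, hv⟩, hv'⟩ := exists_sub_orthogonal_range (H.metric_source.pos x hx)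
    (LinearMap.ker (fderiv ℝ φ x : N →ₗ[ℝ] E)).subtype w
  refine ⟨w - v, ?_, fun v' h' => hv' ⟨v', h'⟩⟩
  rw [map_sub, show fderiv ℝ φ x v = 0 from hv, sub_zero]

/-- Both sides are tested against `v`. Only the horizontal part of `v` matters, and there `dφ` is
isometric, so its adjoint is its inverse. -/
theorem horLift_fderiv (H : IsCoordSubmersion k s h t φ) (hx : x ∈ s)
    {w : N} (hw : ∀ v, fderiv ℝ φ x v = 0 → k x w v = 0) :
    horLift k h φ x (fderiv ℝ φ x w) = w := by
  refine eq_of_form_eq (H.metric_source.pos x hx) fun v => ?_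
  obtain ⟨v', hv', hv'0⟩ := H.exists_horizontal hx v
  rw [H.form_horLift hx, ← hv', H.isometry x hx w v' hw hv'0, ← sub_eq_zero, ← map_sub]
  exact hw _ (by rw [map_sub, hv', sub_self])

theorem fderiv_horLift (H : IsCoordSubmersion k s h t φ) (hx : x ∈ s)
    (u : E) : fderiv ℝ φ x (horLift k h φ x u) = u := by
  obtain ⟨w, rfl⟩ := H.surjective x hx u
  obtain ⟨w', hw', hw'0⟩ := H.exists_horizontal hx w
  rw [← hw', H.horLift_fderiv hx hw'0]

theorem contDiffOn_horLift (H : IsCoordSubmersion k s h t φ)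
    (u : E) : ContDiffOn ℝ ∞ (fun y => horLift k h φ y u) s := by
  have h1 : ContDiffOn ℝ ∞ (fderiv ℝ φ) s :=
    H.contDiffOn.fderiv_of_isOpen H.isOpen_source (by simp)
  have h2 : ContDiffOn ℝ ∞ (fun y => h (φ y)) s :=
    H.metric_target.contDiffOn.comp H.contDiffOn H.mapsTo
  have h3 : ContDiffOn ℝ ∞
      (fun y => (ContinuousLinearMap.compL ℝ N E ℝ).flip (fderiv ℝ φ y)) s :=
    (ContinuousLinearMap.compL ℝ N E ℝ).flip.contDiff.comp_contDiffOn h1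
  exact (H.metric_source.contDiffOn_inverse.clm_comp (h3.clm_comp h2)).clm_apply contDiffOn_const

/-- Second derivatives commute and both connections are torsion-free. -/
theorem mapHessian_symm (H : IsCoordSubmersion k s h t φ) (hx : x ∈ s)
    (z w : N) : mapHessian k h φ x z w = mapHessian k h φ x w z := by
  have hφ : ContDiffAt ℝ ∞ φ x := H.contDiffOn.contDiffAt (H.isOpen_source.mem_nhds hx)
  have : fderiv ℝ (fderiv ℝ φ) x z w = fderiv ℝ (fderiv ℝ φ) x w z :=
    (hφ.isSymmSndFDerivAt (by simpa using WithTop.coe_le_coe.2 (le_top (a := (2 : ℕ∞))))) z w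
  rw [mapHessian, mapHessian, this, H.metric_source.christoffelL_symm H.isOpen_source hx,
    H.metric_target.christoffelL_symm H.isOpen_target (H.mapsTo hx)]

theorem mapHessian_add_right (z w w' : N) :
    mapHessian k h φ x z (w + w') = mapHessian k h φ x z w + mapHessian k h φ x z w' := by
  simp only [mapHessian, map_add]
  abel

theorem hasFDerivAt_fderiv (H : IsCoordSubmersion k s h t φ) (hx : x ∈ s)
    : HasFDerivAt (fderiv ℝ φ) (fderiv ℝ (fderiv ℝ φ) x) x :=
  (((H.contDiffOn.fderiv_of_isOpen H.isOpen_source (m := ∞) (by simp)).contDiffAt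
    (H.isOpen_source.mem_nhds hx)).differentiableAt (by simp)).hasFDerivAt

theorem hasFDerivAt_map (H : IsCoordSubmersion k s h t φ) (hx : x ∈ s)
    : HasFDerivAt φ (fderiv ℝ φ x) x :=
  ((H.contDiffOn.contDiffAt (H.isOpen_source.mem_nhds hx)).differentiableAt
    (by simp)).hasFDerivAt

/-- The covariant derivative of a field `W` that is `φ`-related to the field `c`. -/
theorem fderiv_covDeriv (H : IsCoordSubmersion k s h t φ) (hx : x ∈ s)
    {W : N → N} (hW : ContDiffOn ℝ ∞ W s) {c : E → E}
    (hc : DifferentiableAt ℝ c (φ x)) (hWc : ∀ y ∈ s, fderiv ℝ φ y (W y) = c (φ y)) (z : N) :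
    fderiv ℝ φ x (covDeriv k W x z) =
      covDeriv h c (φ x) (fderiv ℝ φ x z) - mapHessian k h φ x z (W x) := by
  have hW1 : HasFDerivAt W (fderiv ℝ W x) x :=
    ((hW.contDiffAt (H.isOpen_source.mem_nhds hx)).differentiableAt (by simp)).hasFDerivAt
  have h1 := ((H.hasFDerivAt_fderiv hx).clm_apply hW1).fderiv
  have h2 := (hc.hasFDerivAt.comp x (H.hasFDerivAt_map hx)).fderiv
  have h3 : fderiv ℝ (fun y => fderiv ℝ φ y (W y)) x = fderiv ℝ (c ∘ φ) x := by
    apply Filter.EventuallyEq.fderiv_eq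
    filter_upwards [H.isOpen_source.mem_nhds hx] with y hy using hWc y hy
  rw [h1, h2] at h3
  have h4 := congrArg (fun l : N →L[ℝ] E => l z) h3
  simp only [_root_.add_apply, ContinuousLinearMap.comp_apply,
    ContinuousLinearMap.flip_apply] at h4
  rw [covDeriv, covDeriv, mapHessian, map_add, ← h4, hWc x hx]
  abel

/-- This is the adjunction `form_horLift`, with `u` and `w` constant, differentiated along `z`;
metric compatibility upstairs and downstairs turns the derivatives of `k` and `h` into Christoffel
terms. -/
theorem form_covDeriv_horLift (H : IsCoordSubmersion k s h t φ) (hx : x ∈ s) (u : E) (z w : N) :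
    k x (covDeriv k (fun y => horLift k h φ y u) x z) w =
      h (φ x) (christoffelL h (φ x) (fderiv ℝ φ x z) u) (fderiv ℝ φ x w)
        + h (φ x) u (mapHessian k h φ x z w) := by
  have hk : HasFDerivAt k (fderiv ℝ k x) x :=
    ((H.metric_source.contDiffAt H.isOpen_source hx).differentiableAt (by simp)).hasFDerivAt
  have hh : HasFDerivAt h (fderiv ℝ h (φ x)) (φ x) :=
    ((H.metric_target.contDiffAt H.isOpen_target (H.mapsTo hx)).differentiableAt
      (by simp)).hasFDerivAt
  have hL : HasFDerivAt (fun y => horLift k h φ y u)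
      (fderiv ℝ (fun y => horLift k h φ y u) x) x :=
    (((H.contDiffOn_horLift u).contDiffAt (H.isOpen_source.mem_nhds hx)).differentiableAt
      (by simp)).hasFDerivAt
  have h1 := ((hk.clm_apply hL).clm_apply (hasFDerivAt_const w x)).fderiv
  have h2 := (((hh.comp x (H.hasFDerivAt_map hx)).clm_apply (hasFDerivAt_const u x)).clm_apply
    ((H.hasFDerivAt_fderiv hx).clm_apply (hasFDerivAt_const w x))).fderiv
  have h3 : fderiv ℝ (fun y => k y (horLift k h φ y u) w) x
      = fderiv ℝ (fun y => (h ∘ φ) y u (fderiv ℝ φ y w)) x := by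
    apply Filter.EventuallyEq.fderiv_eq
    filter_upwards [H.isOpen_source.mem_nhds hx] with y hy using H.form_horLift hy u w
  rw [h1, h2] at h3
  have h4 := congrArg (fun l : N →L[ℝ] ℝ => l z) h3
  simp only [_root_.add_apply, ContinuousLinearMap.comp_apply, ContinuousLinearMap.flip_apply,
    _root_.zero_apply, map_zero, zero_add, Function.comp_apply,
    H.metric_source.fderiv_apply H.isOpen_source hx,
    H.metric_target.fderiv_apply H.isOpen_target (H.mapsTo hx), H.form_horLift hx] at h4
  rw [covDeriv, mapHessian]
  simp only [map_add, map_sub, _root_.add_apply]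
  linarith

/-- The trilinear form `h(Hess(a, b), c)` on horizontal lifts is symmetric in `a, b` and
antisymmetric in `b, c`, and such a form is zero. -/
theorem mapHessian_horLift (H : IsCoordSubmersion k s h t φ) (hx : x ∈ s) (u v : E) :
    mapHessian k h φ x (horLift k h φ x u) (horLift k h φ x v) = 0 := by
  -- The antisymmetry comes from computing `k(D_a b, c)` twice on lifts: by differentiating the
  -- adjunction, and by pushing the covariant derivative down to the base.
  have key : ∀ a b c : E,
      h (φ x) (mapHessian k h φ x (horLift k h φ x a) (horLift k h φ x b)) c =
      - h (φ x) (mapHessian k h φ x (horLift k h φ x a) (horLift k h φ x c)) b := by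
    intro a b c
    have h1 := H.form_covDeriv_horLift hx b (horLift k h φ x a) (horLift k h φ x c)
    have h2 := H.fderiv_covDeriv hx (H.contDiffOn_horLift b) (c := fun _ => b)
      (differentiableAt_const b) (fun y hy => H.fderiv_horLift hy b) (horLift k h φ x a)
    have hsy := H.metric_source.symm x hx
    have hsy' := H.metric_target.symm _ (H.mapsTo hx)
    rw [hsy, H.form_horLift hx, h2, H.fderiv_horLift hx, H.fderiv_horLift hx, covDeriv,
      fderiv_fun_const, hsy'] at h1
    simp only [Pi.zero_apply, _root_.zero_apply, zero_add, map_sub, _root_.sub_apply] at h1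
    rw [hsy' (mapHessian k h φ x (horLift k h φ x a) (horLift k h φ x c)) b]
    linarith
  refine eq_of_form_eq (H.metric_target.pos _ (H.mapsTo hx)) fun w => ?_
  rw [map_zero, _root_.zero_apply]
  have hs := H.mapHessian_symm hx
  have e1 := key u v w
  have e2 := key w u v
  have e3 := key v w u
  rw [hs (horLift k h φ x u) (horLift k h φ x w)] at e1
  rw [hs (horLift k h φ x w) (horLift k h φ x v)] at e2
  rw [hs (horLift k h φ x v) (horLift k h φ x u)] at e3
  linarith

theorem fderiv_covDeriv_horLift (H : IsCoordSubmersion k s h t φ) (hx : x ∈ s) (u v : E) :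
    fderiv ℝ φ x (covDeriv k (fun y => horLift k h φ y v) x (horLift k h φ x u)) =
      christoffelL h (φ x) u v := by
  rw [H.fderiv_covDeriv hx (H.contDiffOn_horLift v) (c := fun _ => v)
      (differentiableAt_const v) (fun y hy => H.fderiv_horLift hy v), H.mapHessian_horLift hx,
    H.fderiv_horLift hx, covDeriv]
  simp

theorem fderiv_oneillTensor (H : IsCoordSubmersion k s h t φ) (hx : x ∈ s)
    (u v : E) : fderiv ℝ φ x (oneillTensor k h φ x u v) = 0 := by
  rw [oneillTensor, map_sub, H.fderiv_covDeriv_horLift hx, H.fderiv_horLift hx, sub_self]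

theorem form_oneillTensor (H : IsCoordSubmersion k s h t φ) (hx : x ∈ s)
    (u v : E) {w : N} (hw : fderiv ℝ φ x w = 0) :
    k x (oneillTensor k h φ x u v) w = h (φ x) v (mapHessian k h φ x (horLift k h φ x u) w) := by
  rw [oneillTensor, map_sub, _root_.sub_apply, H.form_covDeriv_horLift hx, H.form_horLift hx, hw]
  simp

theorem mapHessian_of_vertical (H : IsCoordSubmersion k s h t φ) (hx : x ∈ s)
    (u : E) {w : N} (hw : fderiv ℝ φ x w = 0) :
    mapHessian k h φ x w (horLift k h φ x u) =
      - fderiv ℝ φ x (covDeriv k (fun y => horLift k h φ y u) x w) := by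
  rw [H.fderiv_covDeriv hx (H.contDiffOn_horLift u) (c := fun _ => u)
      (differentiableAt_const u) (fun y hy => H.fderiv_horLift hy u), covDeriv, hw]
  simp

/-- For vertical `w`, the pairing of the tensor at `(u, v)` with `w` is a Hessian with one vertical
argument, that is `-k(D_w u, v)` on lifts. Differentiating the adjunction along `w` identifies
`k(D_w u, v)` with the pairing at `(v, u)`. The sum of the two tensors is vertical, so it may be
tested against itself. -/
theorem oneillTensor_antisymm (H : IsCoordSubmersion k s h t φ) (hx : x ∈ s) (u v : E) :
    oneillTensor k h φ x u v = - oneillTensor k h φ x v u := by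
  have key : ∀ w, fderiv ℝ φ x w = 0 →
      k x (oneillTensor k h φ x u v) w = - k x (oneillTensor k h φ x v u) w := by
    intro w hw
    rw [H.form_oneillTensor hx u v hw, H.form_oneillTensor hx v u hw, H.mapHessian_symm hx _ w,
      H.mapHessian_of_vertical hx u hw, map_neg, ← H.form_horLift hx, H.metric_source.symm x hx,
      H.form_covDeriv_horLift hx, hw, H.mapHessian_symm hx w]
    simp
  have hz : fderiv ℝ φ x (oneillTensor k h φ x u v + oneillTensor k h φ x v u) = 0 := by
    rw [map_add, H.fderiv_oneillTensor hx, H.fderiv_oneillTensor hx, add_zero]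
  by_contra hne
  have h1 := H.metric_source.pos x hx (oneillTensor k h φ x u v + oneillTensor k h φ x v u)
    (fun h0 => hne (eq_neg_of_add_eq_zero_left h0))
  have h2 := key _ hz
  rw [map_add (k x), _root_.add_apply] at h1
  linarith

/-- O'Neill's formula for horizontal lifts. -/
theorem form_coordCurvature_horLift (H : IsCoordSubmersion k s h t φ) (hx : x ∈ s) (u v : E) :
    h (φ x) (coordCurvature h (φ x) u v v) u =
      k x (coordCurvature k x (horLift k h φ x u) (horLift k h φ x v) (horLift k h φ x v))
        (horLift k h φ x u)
      + 3 * k x (oneillTensor k h φ x u v) (oneillTensor k h φ x u v) := by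
  have hsk := H.metric_source.symm x hx
  have hsh := H.metric_target.symm _ (H.mapsTo hx)
  have hos := H.isOpen_source
  have hanti := H.oneillTensor_antisymm hx
  have hcov : ∀ a b : E, covDeriv k (fun y => horLift k h φ y b) x (horLift k h φ x a) =
      horLift k h φ x (christoffelL h (φ x) a b) + oneillTensor k h φ x a b := by
    intro a b; rw [oneillTensor]; abel
  have hsm : ∀ a b : E, ContDiffOn ℝ ∞
      (fun y => covDeriv k (fun y => horLift k h φ y b) y (horLift k h φ y a)) s := by
    intro a b
    have h1 := (H.contDiffOn_horLift b).fderiv_of_isOpen hos (m := ∞) (by simp)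
    exact (h1.clm_apply (H.contDiffOn_horLift a)).add
      (((H.metric_source.contDiffOn_christoffelL hos).clm_apply
        (H.contDiffOn_horLift a)).clm_apply (H.contDiffOn_horLift b))
  have hΓd : ∀ a b : E, DifferentiableAt ℝ (fun y => christoffelL h y a b) (φ x) := by
    intro a b
    have := ((H.metric_target.contDiffOn_christoffelL H.isOpen_target).contDiffAt
      (H.isOpen_target.mem_nhds (H.mapsTo hx))).differentiableAt (by simp)
    exact (this.clm_apply (differentiableAt_const a)).clm_apply (differentiableAt_const b)
  -- Pairing with a horizontal lift amounts to applying `dφ`. The base term is the iterated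
  -- covariant derivative downstairs; the Hessian correction sees only the vertical part of `D_a b`.
  have hsecond : ∀ a b c d : E,
      k x (covDeriv k (fun y => covDeriv k (fun y => horLift k h φ y b) y (horLift k h φ y a)) x
        (horLift k h φ x c)) (horLift k h φ x d) =
      h (φ x) (covDeriv h (fun y => christoffelL h y a b) (φ x) c) d
        - k x (oneillTensor k h φ x c d) (oneillTensor k h φ x a b) := by
    intro a b c d
    rw [hsk, H.form_horLift hx, H.fderiv_covDeriv hx (hsm a b) (hΓd a b)
      (fun y hy => H.fderiv_covDeriv_horLift hy a b), H.fderiv_horLift hx, hcov,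
      mapHessian_add_right, H.mapHessian_horLift hx, zero_add,
      H.form_oneillTensor hx c d (H.fderiv_oneillTensor hx a b), map_sub, hsh d]
  have huu : oneillTensor k h φ x u u = 0 := by
    have h2 : (2 : ℝ) • oneillTensor k h φ x u u = 0 := by
      rw [two_smul]; nth_rewrite 1 [hanti u u]; exact neg_add_cancel _
    simpa using h2
  -- The bracket of the two lifts: the horizontal parts cancel because the base fields are constant,
  -- and antisymmetry doubles the vertical part.
  have hbr : covDeriv k (fun y => horLift k h φ y v) x (horLift k h φ x u)
      - covDeriv k (fun y => horLift k h φ y u) x (horLift k h φ x v)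
      = (2 : ℝ) • oneillTensor k h φ x u v := by
    rw [hcov, hcov, hanti v u,
      H.metric_target.christoffelL_symm H.isOpen_target (H.mapsTo hx) v u, two_smul]
    abel
  have hvert : fderiv ℝ φ x ((2 : ℝ) • oneillTensor k h φ x u v) = 0 := by
    rw [map_smul, H.fderiv_oneillTensor hx, smul_zero]
  have hthird : k x (covDeriv k (fun y => horLift k h φ y v) x
      ((2 : ℝ) • oneillTensor k h φ x u v)) (horLift k h φ x u) =
      2 * k x (oneillTensor k h φ x u v) (oneillTensor k h φ x u v) := by
    rw [H.form_covDeriv_horLift hx, H.mapHessian_symm hx, ← H.form_oneillTensor hx u v hvert,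
      hvert]
    simp
  have hbase := H.metric_target.coordCurvature_eq H.isOpen_target (X := fun _ => u)
    (Y := fun _ => v) (Z := fun _ => v) contDiffOn_const contDiffOn_const contDiffOn_const
    (H.mapsTo hx)
  have htop := H.metric_source.coordCurvature_eq hos (H.contDiffOn_horLift u)
    (H.contDiffOn_horLift v) (H.contDiffOn_horLift v) hx
  have hconst : ∀ a b : E, (fun y => covDeriv h (fun _ => b) y a) =
      fun y => christoffelL h y a b := by
    intro a b; funext y; simp [covDeriv]
  have hz : covDeriv h (fun _ => v) (φ x) u - covDeriv h (fun _ => u) (φ x) v = 0 := by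
    simp [covDeriv, H.metric_target.christoffelL_symm H.isOpen_target (H.mapsTo hx) v u]
  have hz0 : covDeriv h (fun _ => v) (φ x) 0 = 0 := by simp [covDeriv]
  simp only [hconst] at hbase
  rw [hz, hz0, sub_zero] at hbase
  rw [hbase, htop, hbr]
  -- Of the factor 3, one comes from the mixed second derivative and two from the bracket term; the
  -- remaining second derivative contributes nothing since the tensor vanishes at `(u, u)`.
  simp only [map_sub, _root_.sub_apply, hthird, hsecond, huu, hanti v u, map_neg,
    _root_.neg_apply, map_zero, _root_.zero_apply]
  ring

/-- O'Neill's inequality: Riemannian submersions do not decrease the curvature. -/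
theorem form_coordCurvature_le (H : IsCoordSubmersion k s h t φ) (hx : x ∈ s)
    {u v : N} (hu : ∀ w, fderiv ℝ φ x w = 0 → k x u w = 0)
    (hv : ∀ w, fderiv ℝ φ x w = 0 → k x v w = 0) :
    k x (coordCurvature k x u v v) u ≤
      h (φ x) (coordCurvature h (φ x) (fderiv ℝ φ x u) (fderiv ℝ φ x v) (fderiv ℝ φ x v))
        (fderiv ℝ φ x u) := by
  rw [H.form_coordCurvature_horLift hx, H.horLift_fderiv hx hu, H.horLift_fderiv hx hv]
  have : ∀ w, 0 ≤ k x w w := fun w => by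
    by_cases hw : w = 0
    · simp [hw]
    · exact (H.metric_source.pos x hx w hw).le
  linarith [this (oneillTensor k h φ x (fderiv ℝ φ x u) (fderiv ℝ φ x v))]

end IsCoordSubmersion

end ONeill

/-! ## Products in coordinates -/

section ProductCoordinates

variable {E₁ : Type*} [NormedAddCommGroup E₁] [NormedSpace ℝ E₁] [FiniteDimensional ℝ E₁]
  {E₂ : Type*} [NormedAddCommGroup E₂] [NormedSpace ℝ E₂] [FiniteDimensional ℝ E₂]

/-- The product of two metrics given in coordinates. -/
def prodMetric (k₁ : E₁ → E₁ →L[ℝ] E₁ →L[ℝ] ℝ) (k₂ : E₂ → E₂ →L[ℝ] E₂ →L[ℝ] ℝ) (y : E₁ × E₂) :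
    E₁ × E₂ →L[ℝ] E₁ × E₂ →L[ℝ] ℝ :=
  pullbackForm (k₁ y.1) (ContinuousLinearMap.fst ℝ E₁ E₂) +
    pullbackForm (k₂ y.2) (ContinuousLinearMap.snd ℝ E₁ E₂)

variable {k₁ : E₁ → E₁ →L[ℝ] E₁ →L[ℝ] ℝ} {k₂ : E₂ → E₂ →L[ℝ] E₂ →L[ℝ] ℝ}
  {s₁ : Set E₁} {s₂ : Set E₂}

theorem prodMetric_apply (y u v : E₁ × E₂) :
    prodMetric k₁ k₂ y u v = k₁ y.1 u.1 v.1 + k₂ y.2 u.2 v.2 := rfl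

theorem IsMetricOn.prod (h₁ : IsMetricOn k₁ s₁) (h₂ : IsMetricOn k₂ s₂) :
    IsMetricOn (prodMetric k₁ k₂) (s₁ ×ˢ s₂) where
  contDiffOn := by
    have a₁ : ContDiffOn ℝ ∞ (fun y : E₁ × E₂ => k₁ y.1) (s₁ ×ˢ s₂) :=
      h₁.contDiffOn.comp contDiff_fst.contDiffOn (fun y hy => hy.1)
    have a₂ : ContDiffOn ℝ ∞ (fun y : E₁ × E₂ => k₂ y.2) (s₁ ×ˢ s₂) :=
      h₂.contDiffOn.comp contDiff_snd.contDiffOn (fun y hy => hy.2)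
    exact (contDiffOn_const.clm_comp (a₁.clm_comp contDiffOn_const)).add
      (contDiffOn_const.clm_comp (a₂.clm_comp contDiffOn_const))
  symm y hy u v := by
    rw [prodMetric_apply, prodMetric_apply, h₁.symm _ hy.1, h₂.symm _ hy.2]
  pos y hy v hv := by
    have n₁ : 0 ≤ k₁ y.1 v.1 v.1 := by
      by_cases h : v.1 = 0
      · simp [h]
      · exact (h₁.pos _ hy.1 _ h).le
    have n₂ : 0 ≤ k₂ y.2 v.2 v.2 := by
      by_cases h : v.2 = 0
      · simp [h]
      · exact (h₂.pos _ hy.2 _ h).le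
    rw [prodMetric_apply]
    by_cases h : v.1 = 0
    · have : v.2 ≠ 0 := fun h' => hv (Prod.ext h h')
      linarith [h₂.pos _ hy.2 _ this]
    · linarith [h₁.pos _ hy.1 _ h]

theorem fderiv_prodMetric {y : E₁ × E₂} (h₁ : DifferentiableAt ℝ k₁ y.1)
    (h₂ : DifferentiableAt ℝ k₂ y.2) (z u v : E₁ × E₂) :
    fderiv ℝ (prodMetric k₁ k₂) y z u v =
      fderiv ℝ k₁ y.1 z.1 u.1 v.1 + fderiv ℝ k₂ y.2 z.2 u.2 v.2 := by
  have a₁ := h₁.hasFDerivAt.comp y (hasFDerivAt_fst (𝕜 := ℝ) (p := y))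
  have a₂ := h₂.hasFDerivAt.comp y (hasFDerivAt_snd (𝕜 := ℝ) (p := y))
  have b₁ := (hasFDerivAt_const
    (ContinuousLinearMap.precomp ℝ (ContinuousLinearMap.fst ℝ E₁ E₂)) y).clm_comp
    (a₁.clm_comp (hasFDerivAt_const (ContinuousLinearMap.fst ℝ E₁ E₂) y))
  have b₂ := (hasFDerivAt_const
    (ContinuousLinearMap.precomp ℝ (ContinuousLinearMap.snd ℝ E₁ E₂)) y).clm_comp
    (a₂.clm_comp (hasFDerivAt_const (ContinuousLinearMap.snd ℝ E₁ E₂) y))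
  have c : fderiv ℝ (prodMetric k₁ k₂) y = _ := (b₁.add b₂).fderiv
  rw [c]
  simp

/-- The Koszul expression of a product metric is the sum of those of the factors, and it determines
the Christoffel symbols. -/
theorem christoffelL_prodMetric (h₁ : IsMetricOn k₁ s₁) (h₂ : IsMetricOn k₂ s₂)
    (ho₁ : IsOpen s₁) (ho₂ : IsOpen s₂) {y : E₁ × E₂} (hy : y ∈ s₁ ×ˢ s₂) (u v : E₁ × E₂) :
    christoffelL (prodMetric k₁ k₂) y u v =
      (christoffelL k₁ y.1 u.1 v.1, christoffelL k₂ y.2 u.2 v.2) := by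
  refine eq_of_form_eq ((h₁.prod h₂).pos y hy) fun w => ?_
  have d₁ := (h₁.contDiffAt ho₁ hy.1).differentiableAt (by simp)
  have d₂ := (h₂.contDiffAt ho₂ hy.2).differentiableAt (by simp)
  rw [(h₁.prod h₂).form_christoffelL hy, prodMetric_apply, h₁.form_christoffelL hy.1,
    h₂.form_christoffelL hy.2, fderiv_prodMetric d₁ d₂, fderiv_prodMetric d₁ d₂,
    fderiv_prodMetric d₁ d₂]
  ring

theorem coordCurvature_prodMetric (h₁ : IsMetricOn k₁ s₁) (h₂ : IsMetricOn k₂ s₂)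
    (ho₁ : IsOpen s₁) (ho₂ : IsOpen s₂) {y : E₁ × E₂} (hy : y ∈ s₁ ×ˢ s₂) (u v w : E₁ × E₂) :
    coordCurvature (prodMetric k₁ k₂) y u v w =
      (coordCurvature k₁ y.1 u.1 v.1 w.1, coordCurvature k₂ y.2 u.2 v.2 w.2) := by
  have hΓ : ∀ a b : E₁ × E₂, ∀ x ∈ s₁ ×ˢ s₂, christoffel (prodMetric k₁ k₂) x a b =
      (christoffel k₁ x.1 a.1 b.1, christoffel k₂ x.2 a.2 b.2) := by
    intro a b x hx
    simp only [← christoffelL_apply]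
    exact christoffelL_prodMetric h₁ h₂ ho₁ ho₂ hx a b
  have hd : ∀ a b z : E₁ × E₂, fderiv ℝ (fun x => christoffel (prodMetric k₁ k₂) x a b) y z =
      (fderiv ℝ (fun x => christoffel k₁ x a.1 b.1) y.1 z.1,
        fderiv ℝ (fun x => christoffel k₂ x a.2 b.2) y.2 z.2) := by
    intro a b z
    have e : (fun x => christoffel (prodMetric k₁ k₂) x a b) =ᶠ[nhds y]
        fun x => (christoffel k₁ x.1 a.1 b.1, christoffel k₂ x.2 a.2 b.2) := by
      filter_upwards [(ho₁.prod ho₂).mem_nhds hy] with x hx using hΓ a b x hx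
    have f₁ : DifferentiableAt ℝ (fun x => christoffel k₁ x a.1 b.1) y.1 := by
      simp only [← christoffelL_apply]
      exact ((((h₁.contDiffOn_christoffelL ho₁).contDiffAt (ho₁.mem_nhds hy.1)).differentiableAt
        (by simp)).clm_apply (differentiableAt_const _)).clm_apply (differentiableAt_const _)
    have f₂ : DifferentiableAt ℝ (fun x => christoffel k₂ x a.2 b.2) y.2 := by
      simp only [← christoffelL_apply]
      exact ((((h₂.contDiffOn_christoffelL ho₂).contDiffAt (ho₂.mem_nhds hy.2)).differentiableAt
        (by simp)).clm_apply (differentiableAt_const _)).clm_apply (differentiableAt_const _)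
    have g := (f₁.hasFDerivAt.comp y (hasFDerivAt_fst (𝕜 := ℝ) (p := y))).prodMk
      (f₂.hasFDerivAt.comp y (hasFDerivAt_snd (𝕜 := ℝ) (p := y)))
    have g' : fderiv ℝ
      (fun x : E₁ × E₂ => (christoffel k₁ x.1 a.1 b.1, christoffel k₂ x.2 a.2 b.2)) y = _ :=
      g.fderiv
    rw [e.fderiv_eq, g']
    simp
  rw [coordCurvature, hd, hd, hΓ _ _ y hy, hΓ _ _ y hy, hΓ _ _ y hy, hΓ _ _ y hy]
  rfl

end ProductCoordinates

/-! ## Metrics in charts -/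

section Charts

variable {E : Type*} [NormedAddCommGroup E] [NormedSpace ℝ E]
  {M : Type*} [TopologicalSpace M] [ChartedSpace E M] [IsManifold 𝓘(ℝ, E) ∞ M]

theorem mdifferentiableAt_extChartAt_symm (x : M) {y : E}
    (hy : y ∈ (extChartAt 𝓘(ℝ, E) x).target) :
    MDifferentiableAt 𝓘(ℝ, E) 𝓘(ℝ, E) (extChartAt 𝓘(ℝ, E) x).symm y := by
  have : IsManifold 𝓘(ℝ, E) 1 M := IsManifold.of_le (n := ∞) (by simp)
  have := mdifferentiableWithinAt_extChartAt_symm (I := 𝓘(ℝ, E)) hy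
  simpa [mdifferentiableWithinAt_univ] using this

theorem isInvertible_mfderiv_extChartAt_symm (x : M) {y : E}
    (hy : y ∈ (extChartAt 𝓘(ℝ, E) x).target) :
    (mfderiv 𝓘(ℝ, E) 𝓘(ℝ, E) (extChartAt 𝓘(ℝ, E) x).symm y).IsInvertible := by
  have : IsManifold 𝓘(ℝ, E) 1 M := IsManifold.of_le (n := ∞) (by simp)
  have := isInvertible_mfderivWithin_extChartAt_symm (I := 𝓘(ℝ, E)) hy
  simpa [mfderivWithin_univ] using this

theorem mfderiv_extChartAt_symm_mfderiv (x : M) {z : M}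
    (hz : z ∈ (extChartAt 𝓘(ℝ, E) x).source) (a : TangentSpace 𝓘(ℝ, E) z) :
    mfderiv 𝓘(ℝ, E) 𝓘(ℝ, E) (extChartAt 𝓘(ℝ, E) x).symm (extChartAt 𝓘(ℝ, E) x z)
      (mfderiv 𝓘(ℝ, E) 𝓘(ℝ, E) (extChartAt 𝓘(ℝ, E) x) z a) = a := by
  have : IsManifold 𝓘(ℝ, E) 1 M := IsManifold.of_le (n := ∞) (by simp)
  have := mfderivWithin_extChartAt_symm_comp_mfderiv_extChartAt' (I := 𝓘(ℝ, E)) hz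
  rw [modelWithCornersSelf_coe, Set.range_id, mfderivWithin_univ] at this
  exact congrArg (fun l : E →L[ℝ] E => l a) this

theorem metricInChart_apply_mfderiv (g : SmoothMetric E M) (x : M) {z : M}
    (hz : z ∈ (extChartAt 𝓘(ℝ, E) x).source) (a b : TangentSpace 𝓘(ℝ, E) z) :
    metricInChart g x (extChartAt 𝓘(ℝ, E) x z)
      (mfderiv 𝓘(ℝ, E) 𝓘(ℝ, E) (extChartAt 𝓘(ℝ, E) x) z a)
      (mfderiv 𝓘(ℝ, E) 𝓘(ℝ, E) (extChartAt 𝓘(ℝ, E) x) z b) = g.inner z a b := by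
  -- The round trip through the chart returns `z` only up to a propositional equality, so the base
  -- point and both vectors have to be replaced together.
  have key : ∀ (z' : M) (a' b' : E), z' = z → a' = a → b' = b →
      g.inner z' (a' : TangentSpace 𝓘(ℝ, E) z') (b' : TangentSpace 𝓘(ℝ, E) z') =
        g.inner z a b := by
    rintro z' a' b' rfl rfl rfl; rfl
  exact key _ _ _ ((extChartAt 𝓘(ℝ, E) x).left_inv hz)
    (mfderiv_extChartAt_symm_mfderiv x hz a) (mfderiv_extChartAt_symm_mfderiv x hz b)

variable [FiniteDimensional ℝ E]

theorem isMetricOn_metricInChart (g : SmoothMetric E M) (x : M) :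
    IsMetricOn (metricInChart g x) (extChartAt 𝓘(ℝ, E) x).target where
  contDiffOn := by
    have : IsManifold 𝓘(ℝ, E) 1 M := IsManifold.of_le (n := ∞) (by simp)
    rw [contDiffOn_clm_apply]
    intro u
    rw [contDiffOn_clm_apply]
    intro v
    rw [← contMDiffOn_iff_contDiffOn]
    have ho := isOpen_extChartAt_target (I := 𝓘(ℝ, E)) x
    have hsym : ContMDiffOn 𝓘(ℝ, E) 𝓘(ℝ, E) ∞ (extChartAt 𝓘(ℝ, E) x).symm
      (extChartAt 𝓘(ℝ, E) x).target := contMDiffOn_extChartAt_symm x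
    -- The coordinate field of a constant `u` is smooth along the inverse chart, being the tangent
    -- map of that chart applied to a constant section. Evaluating the smooth metric on two such
    -- fields gives the coefficients.
    have hvec : ∀ u : E, ContMDiffOn 𝓘(ℝ, E) (𝓘(ℝ, E).prod 𝓘(ℝ, E)) ∞
        (fun y => TotalSpace.mk' E (E := fun x : M => TangentSpace 𝓘(ℝ, E) x)
          ((extChartAt 𝓘(ℝ, E) x).symm y)
          (mfderiv 𝓘(ℝ, E) 𝓘(ℝ, E) (extChartAt 𝓘(ℝ, E) x).symm y u))
        (extChartAt 𝓘(ℝ, E) x).target := by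
      intro u
      have h1 := hsym.contMDiffOn_tangentMapWithin (m := ∞) (by simp) ho.uniqueMDiffOn
      have h2 : ContMDiff 𝓘(ℝ, E) (𝓘(ℝ, E).prod 𝓘(ℝ, E)) ∞
          (fun y => TotalSpace.mk' E (E := fun x : E => TangentSpace 𝓘(ℝ, E) x) y u) :=
        contMDiff_vectorSpace_iff_contDiff.2 (contDiff_const (c := u))
      refine (h1.comp h2.contMDiffOn (fun y hy => hy)).congr fun y hy => ?_
      simp only [Function.comp_apply, tangentMapWithin]
      rw [mfderivWithin_of_isOpen ho hy]
    intro y hy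
    have : ContMDiffWithinAt 𝓘(ℝ, E) (𝓘(ℝ, E).prod 𝓘(ℝ)) ∞
        (fun y => TotalSpace.mk' ℝ (E := Bundle.Trivial M ℝ) ((extChartAt 𝓘(ℝ, E) x).symm y)
          (g.inner ((extChartAt 𝓘(ℝ, E) x).symm y)
            (mfderiv 𝓘(ℝ, E) 𝓘(ℝ, E) (extChartAt 𝓘(ℝ, E) x).symm y u)
            (mfderiv 𝓘(ℝ, E) 𝓘(ℝ, E) (extChartAt 𝓘(ℝ, E) x).symm y v)))
        (extChartAt 𝓘(ℝ, E) x).target y := by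
      apply ContMDiffWithinAt.clm_bundle_apply₂ (F₁ := E) (F₂ := E)
      · exact ContMDiffAt.comp_contMDiffWithinAt y g.contMDiff.contMDiffAt (hsym y hy)
      · exact hvec u y hy
      · exact hvec v y hy
    simp only [contMDiffWithinAt_totalSpace] at this
    exact this.2
  symm y _ u v := g.symm _ _ _
  pos y hy v hv := g.pos _ _ fun h0 => hv <| by
    have := (isInvertible_mfderiv_extChartAt_symm x hy).injective
    exact this (h0.trans (map_zero _).symm)

end Charts

/-! ## O'Neill's inequality for submersions from a product -/

section Submersion

variable {E₁ : Type*} [NormedAddCommGroup E₁] [NormedSpace ℝ E₁]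
  {M₁ : Type*} [TopologicalSpace M₁] [ChartedSpace E₁ M₁] [IsManifold 𝓘(ℝ, E₁) ∞ M₁]
  {E₂ : Type*} [NormedAddCommGroup E₂] [NormedSpace ℝ E₂]
  {M₂ : Type*} [TopologicalSpace M₂] [ChartedSpace E₂ M₂] [IsManifold 𝓘(ℝ, E₂) ∞ M₂]
  {E : Type*} [NormedAddCommGroup E] [NormedSpace ℝ E]
  {M : Type*} [TopologicalSpace M] [ChartedSpace E M] [IsManifold 𝓘(ℝ, E) ∞ M]

/-- The parametrization of `M₁ × M₂` near `(p, q)` by the product of the preferred charts. -/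
def prodParam (p : M₁) (q : M₂) (y : E₁ × E₂) : M₁ × M₂ :=
  ((extChartAt 𝓘(ℝ, E₁) p).symm y.1, (extChartAt 𝓘(ℝ, E₂) q).symm y.2)

/-- The differential of `prodParam`. -/
def prodParamDeriv (p : M₁) (q : M₂) (y : E₁ × E₂) : E₁ × E₂ →L[ℝ] E₁ × E₂ :=
  (mfderiv 𝓘(ℝ, E₁) 𝓘(ℝ, E₁) (extChartAt 𝓘(ℝ, E₁) p).symm y.1 : E₁ →L[ℝ] E₁).prodMap
    (mfderiv 𝓘(ℝ, E₂) 𝓘(ℝ, E₂) (extChartAt 𝓘(ℝ, E₂) q).symm y.2 : E₂ →L[ℝ] E₂)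

variable {p : M₁} {q : M₂}

theorem contMDiffOn_prodParam : ContMDiffOn 𝓘(ℝ, E₁ × E₂) (𝓘(ℝ, E₁).prod 𝓘(ℝ, E₂)) ∞
    (prodParam p q) ((extChartAt 𝓘(ℝ, E₁) p).target ×ˢ (extChartAt 𝓘(ℝ, E₂) q).target) := by
  refine ContMDiffOn.prodMk ?_ ?_
  · exact (contMDiffOn_extChartAt_symm p).comp
      contDiff_fst.contMDiff.contMDiffOn (fun y hy => hy.1)
  · exact (contMDiffOn_extChartAt_symm q).comp
      contDiff_snd.contMDiff.contMDiffOn (fun y hy => hy.2)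

theorem hasMFDerivAt_prodParam {y : E₁ × E₂}
    (hy : y ∈ (extChartAt 𝓘(ℝ, E₁) p).target ×ˢ (extChartAt 𝓘(ℝ, E₂) q).target) :
    HasMFDerivAt 𝓘(ℝ, E₁ × E₂) (𝓘(ℝ, E₁).prod 𝓘(ℝ, E₂)) (prodParam p q) y
      (prodParamDeriv p q y) := by
  have h₁ := (mdifferentiableAt_extChartAt_symm p hy.1).hasMFDerivAt.comp y
    (ContinuousLinearMap.fst ℝ E₁ E₂).hasMFDerivAt
  have h₂ := (mdifferentiableAt_extChartAt_symm q hy.2).hasMFDerivAt.comp y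
    (ContinuousLinearMap.snd ℝ E₁ E₂).hasMFDerivAt
  exact h₁.prodMk h₂

theorem surjective_prodParamDeriv {y : E₁ × E₂}
    (hy : y ∈ (extChartAt 𝓘(ℝ, E₁) p).target ×ˢ (extChartAt 𝓘(ℝ, E₂) q).target) :
    Function.Surjective (prodParamDeriv p q y) :=
  (isInvertible_mfderiv_extChartAt_symm p hy.1).surjective.prodMap
    (isInvertible_mfderiv_extChartAt_symm q hy.2).surjective

/-- The expression in charts of `φ : M₁ × M₂ → M`. -/
def inCharts (φ : M₁ × M₂ → M) (p : M₁) (q : M₂) (y : E₁ × E₂) : E :=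
  extChartAt 𝓘(ℝ, E) (φ (p, q)) (φ (prodParam p q y))

/-- The set on which the expression in charts of `φ` is considered. -/
def inChartsSource (φ : M₁ × M₂ → M) (p : M₁) (q : M₂) : Set (E₁ × E₂) :=
  ((extChartAt 𝓘(ℝ, E₁) p).target ×ˢ (extChartAt 𝓘(ℝ, E₂) q).target) ∩
    (fun y => φ (prodParam p q y)) ⁻¹' (extChartAt 𝓘(ℝ, E) (φ (p, q))).source

/-- The differential at `z` of the preferred chart at `x`, on model spaces. -/
def chartDeriv (x z : M) : E →L[ℝ] E := mfderiv 𝓘(ℝ, E) 𝓘(ℝ, E) (extChartAt 𝓘(ℝ, E) x) z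

/-- The differential of `φ : M₁ × M₂ → M`, on model spaces. -/
def modelDeriv (φ : M₁ × M₂ → M) (z : M₁ × M₂) : E₁ × E₂ →L[ℝ] E :=
  mfderiv (𝓘(ℝ, E₁).prod 𝓘(ℝ, E₂)) 𝓘(ℝ, E) φ z

variable {φ : M₁ × M₂ → M}

/-- The point `z` is a separate variable so that the derivative can be stated at `(p, q)` itself,
which is only propositionally the image of its own coordinates. -/
theorem hasFDerivAt_inCharts (hφ : ContMDiff (𝓘(ℝ, E₁).prod 𝓘(ℝ, E₂)) 𝓘(ℝ, E) ∞ φ)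
    {y : E₁ × E₂} (hy : y ∈ inChartsSource (E := E) φ p q) {z : M₁ × M₂}
    (hz : prodParam p q y = z) :
    HasFDerivAt (inCharts (E := E) φ p q)
      (chartDeriv (φ (p, q)) (φ z) ∘L modelDeriv φ z ∘L prodParamDeriv p q y) y := by
  subst hz
  have : IsManifold 𝓘(ℝ, E) 1 M := IsManifold.of_le (n := ∞) (by simp)
  have h₁ := hasMFDerivAt_prodParam hy.1
  have h₂ := (hφ.mdifferentiable (by simp) (prodParam p q y)).hasMFDerivAt
  have h₃ := (mdifferentiableAt_extChartAt (I := 𝓘(ℝ, E)) (x := φ (p, q))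
    (y := φ (prodParam p q y)) (by simpa using hy.2)).hasMFDerivAt
  exact (h₃.comp y (h₂.comp y h₁)).hasFDerivAt

variable [FiniteDimensional ℝ E₁] [FiniteDimensional ℝ E₂] [FiniteDimensional ℝ E]
  {g₁ : SmoothMetric E₁ M₁} {g₂ : SmoothMetric E₂ M₂} {h : SmoothMetric E M}

/-- The charts are isometries for the transported metrics and their differentials are invertible, so
kernels, horizontality and the isometry condition carry over. -/
theorem IsRiemannianSubmersion.isCoordSubmersion
    (H : IsRiemannianSubmersion (prodInner g₁ 1 g₂) h φ) (p : M₁) (q : M₂) :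
    IsCoordSubmersion (prodMetric (metricInChart g₁ p) (metricInChart g₂ q))
      (inChartsSource (E := E) φ p q) (metricInChart h (φ (p, q)))
      (extChartAt 𝓘(ℝ, E) (φ (p, q))).target (inCharts φ p q) := by
  have ho : IsOpen ((extChartAt 𝓘(ℝ, E₁) p).target ×ˢ (extChartAt 𝓘(ℝ, E₂) q).target) :=
    (isOpen_extChartAt_target p).prod (isOpen_extChartAt_target q)
  have hcomp : ContMDiffOn 𝓘(ℝ, E₁ × E₂) 𝓘(ℝ, E) ∞ (fun y => φ (prodParam p q y))
      ((extChartAt 𝓘(ℝ, E₁) p).target ×ˢ (extChartAt 𝓘(ℝ, E₂) q).target) :=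
    H.contMDiff.comp_contMDiffOn contMDiffOn_prodParam
  have hprod := (isMetricOn_metricInChart g₁ p).prod (isMetricOn_metricInChart g₂ q)
  have hinner : ∀ y u v : E₁ × E₂, prodMetric (metricInChart g₁ p) (metricInChart g₂ q) y u v =
      prodInner g₁ 1 g₂ (prodParam p q y) (prodParamDeriv p q y u) (prodParamDeriv p q y v) := by
    intro y u v
    simp only [prodInner, one_mul]
    rfl
  have hinj : ∀ y : E₁ × E₂, y ∈ inChartsSource (E := E) φ p q →
      (mfderiv 𝓘(ℝ, E) 𝓘(ℝ, E) (extChartAt 𝓘(ℝ, E) (φ (p, q)))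
        (φ (prodParam p q y))).IsInvertible := by
    intro y hy
    have : IsManifold 𝓘(ℝ, E) 1 M := IsManifold.of_le (n := ∞) (by simp)
    exact isInvertible_mfderiv_extChartAt hy.2
  have hhor : ∀ y : E₁ × E₂, y ∈ inChartsSource (E := E) φ p q → ∀ u : E₁ × E₂,
      (∀ w, fderiv ℝ (inCharts (E := E) φ p q) y w = 0 →
        prodMetric (metricInChart g₁ p) (metricInChart g₂ q) y u w = 0) →
      ∀ w, mfderiv (𝓘(ℝ, E₁).prod 𝓘(ℝ, E₂)) 𝓘(ℝ, E) φ (prodParam p q y) w = 0 →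
        prodInner g₁ 1 g₂ (prodParam p q y) (prodParamDeriv p q y u) w = 0 := by
    intro y hy u hu w hw
    obtain ⟨w', rfl⟩ := surjective_prodParamDeriv hy.1 w
    rw [← hinner]
    refine hu w' ?_
    rw [(hasFDerivAt_inCharts H.contMDiff hy rfl).fderiv]
    simp only [ContinuousLinearMap.comp_apply]
    exact (congrArg _ hw).trans (map_zero _)
  exact
  { isOpen_source := hcomp.continuousOn.isOpen_inter_preimage ho (isOpen_extChartAt_source _)
    isOpen_target := isOpen_extChartAt_target _
    metric_source := ⟨hprod.contDiffOn.mono Set.inter_subset_left,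
      fun y hy => hprod.symm y hy.1, fun y hy => hprod.pos y hy.1⟩
    metric_target := isMetricOn_metricInChart h _
    mapsTo := fun y hy => (extChartAt 𝓘(ℝ, E) (φ (p, q))).map_source hy.2
    contDiffOn := by
      rw [← contMDiffOn_iff_contDiffOn]
      exact (contMDiffOn_extChartAt (I := 𝓘(ℝ, E)) (n := ∞) (x := φ (p, q))).comp
        (hcomp.mono Set.inter_subset_left) (fun y hy => by simpa using hy.2)
    surjective := fun y hy => by
      rw [(hasFDerivAt_inCharts H.contMDiff hy rfl).fderiv]
      exact (hinj y hy).surjective.comp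
        ((H.surjective_mfderiv _).comp (surjective_prodParamDeriv hy.1))
    isometry := fun y hy u v hu hv => by
      rw [hinner, ← H.isometry _ _ _ (hhor y hy u hu) (hhor y hy v hv),
        (hasFDerivAt_inCharts H.contMDiff hy rfl).fderiv]
      exact metricInChart_apply_mfderiv h _ hy.2 _ _ }

/-- O'Neill's inequality for a Riemannian submersion from a product. -/
theorem IsRiemannianSubmersion.sec_add_sec_le
    (H : IsRiemannianSubmersion (prodInner g₁ 1 g₂) h φ) (p : M₁) (q : M₂)
    (u₁ v₁ : TangentSpace 𝓘(ℝ, E₁) p) (u₂ v₂ : TangentSpace 𝓘(ℝ, E₂) q)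
    (hu : ∀ w, mfderiv (𝓘(ℝ, E₁).prod 𝓘(ℝ, E₂)) 𝓘(ℝ, E) φ (p, q) w = 0 →
      prodInner g₁ 1 g₂ (p, q) (tangentPair p q u₁ u₂) w = 0)
    (hv : ∀ w, mfderiv (𝓘(ℝ, E₁).prod 𝓘(ℝ, E₂)) 𝓘(ℝ, E) φ (p, q) w = 0 →
      prodInner g₁ 1 g₂ (p, q) (tangentPair p q v₁ v₂) w = 0) :
    sec g₁ p u₁ v₁ + sec g₂ q u₂ v₂ ≤
      sec h (φ (p, q))
        (mfderiv (𝓘(ℝ, E₁).prod 𝓘(ℝ, E₂)) 𝓘(ℝ, E) φ (p, q) (tangentPair p q u₁ u₂))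
        (mfderiv (𝓘(ℝ, E₁).prod 𝓘(ℝ, E₂)) 𝓘(ℝ, E) φ (p, q) (tangentPair p q v₁ v₂)) := by
  have : IsManifold 𝓘(ℝ, E) 1 M := IsManifold.of_le (n := ∞) (by simp)
  have : IsManifold 𝓘(ℝ, E₁) 1 M₁ := IsManifold.of_le (n := ∞) (by simp)
  have : IsManifold 𝓘(ℝ, E₂) 1 M₂ := IsManifold.of_le (n := ∞) (by simp)
  let d₁ : E₁ →L[ℝ] E₁ := chartDeriv p p
  let d₂ : E₂ →L[ℝ] E₂ := chartDeriv q q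
  let y : E₁ × E₂ := (extChartAt 𝓘(ℝ, E₁) p p, extChartAt 𝓘(ℝ, E₂) q q)
  have hz : prodParam p q y = (p, q) := Prod.ext (extChartAt_to_inv p) (extChartAt_to_inv q)
  have hy : y ∈ inChartsSource (E := E) φ p q := by
    refine ⟨⟨mem_extChartAt_target p, mem_extChartAt_target q⟩, ?_⟩
    rw [Set.mem_preimage, hz]
    exact mem_extChartAt_source _
  have hval : inCharts (E := E) φ p q y = extChartAt 𝓘(ℝ, E) (φ (p, q)) (φ (p, q)) := by
    rw [inCharts, hz]
  have hD : ∀ (a : E₁) (b : E₂),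
      prodParamDeriv p q y (d₁ a, d₂ b) = (a, b) := fun a b =>
    Prod.ext (mfderiv_extChartAt_symm_mfderiv p (mem_extChartAt_source p) a)
      (mfderiv_extChartAt_symm_mfderiv q (mem_extChartAt_source q) b)
  let de : E →L[ℝ] E := chartDeriv (φ (p, q)) (φ (p, q))
  let dφ : E₁ × E₂ →L[ℝ] E := modelDeriv φ (p, q)
  have hF : fderiv ℝ (inCharts (E := E) φ p q) y = de ∘L dφ ∘L prodParamDeriv p q y := by
    exact (hasFDerivAt_inCharts H.contMDiff hy hz).fderiv
  have hFa : ∀ (a : E₁) (b : E₂),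
      fderiv ℝ (inCharts (E := E) φ p q) y (d₁ a, d₂ b) = de (dφ (a, b)) := by
    intro a b
    rw [hF, ContinuousLinearMap.comp_apply, ContinuousLinearMap.comp_apply, hD]
  have hhor : ∀ (a : E₁) (b : E₂),
      (∀ w, mfderiv (𝓘(ℝ, E₁).prod 𝓘(ℝ, E₂)) 𝓘(ℝ, E) φ (p, q) w = 0 →
        prodInner g₁ 1 g₂ (p, q) (tangentPair p q a b) w = 0) →
      ∀ w, fderiv ℝ (inCharts (E := E) φ p q) y w = 0 →
        prodMetric (metricInChart g₁ p) (metricInChart g₂ q) y (d₁ a, d₂ b) w = 0 := by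
    intro a b hab w hw
    obtain ⟨w₁, hw₁⟩ : ∃ w₁ : E₁, d₁ w₁ = w.1 := (isInvertible_mfderiv_extChartAt
      (I := 𝓘(ℝ, E₁)) (mem_extChartAt_source p)).surjective w.1
    obtain ⟨w₂, hw₂⟩ : ∃ w₂ : E₂, d₂ w₂ = w.2 := (isInvertible_mfderiv_extChartAt
      (I := 𝓘(ℝ, E₂)) (mem_extChartAt_source q)).surjective w.2
    have hw12 : w = (d₁ w₁, d₂ w₂) := Prod.ext hw₁.symm hw₂.symm
    have hinj : Function.Injective de := (isInvertible_mfderiv_extChartAt (I := 𝓘(ℝ, E))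
      (mem_extChartAt_source (φ (p, q)))).injective
    rw [hw12, hFa] at hw
    have h0 := hab (tangentPair p q w₁ w₂) (hinj (hw.trans (map_zero _).symm))
    rw [hw12, prodMetric_apply]
    have e₁ := metricInChart_apply_mfderiv g₁ p (mem_extChartAt_source p) a w₁
    have e₂ := metricInChart_apply_mfderiv g₂ q (mem_extChartAt_source q) b w₂
    simp only [prodInner, one_mul] at h0
    exact (congrArg₂ (· + ·) e₁ e₂).trans h0
  let a₁ : E₁ := u₁
  let b₁ : E₁ := v₁
  let a₂ : E₂ := u₂
  let b₂ : E₂ := v₂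
  have key := (H.isCoordSubmersion p q).form_coordCurvature_le hy (hhor a₁ a₂ hu)
    (hhor b₁ b₂ hv)
  rw [coordCurvature_prodMetric (isMetricOn_metricInChart g₁ p) (isMetricOn_metricInChart g₂ q)
    (isOpen_extChartAt_target p) (isOpen_extChartAt_target q) hy.1, prodMetric_apply, hFa, hFa,
    hval] at key
  exact key

end Submersion

/-! ## The differential of the projection to the associated bundle -/

/-- Needed for the chain rule at points such as `1 • p`, which equals `p` only propositionally. -/
theorem _root_.MDifferentiableAt.hasMFDerivAt_of_eq {E H E' H' : Type*} [NormedAddCommGroup E]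
    [NormedSpace ℝ E] [TopologicalSpace H] {I : ModelWithCorners ℝ E H}
    [NormedAddCommGroup E'] [NormedSpace ℝ E'] [TopologicalSpace H'] {J : ModelWithCorners ℝ E' H'}
    {M : Type*} [TopologicalSpace M] [ChartedSpace H M]
    {N : Type*} [TopologicalSpace N] [ChartedSpace H' N] {f : M → N} {x y : M}
    (hf : MDifferentiableAt I J f y) (hxy : x = y) :
    HasMFDerivAt I J f x (mfderiv I J f y) := by
  subst hxy
  exact hf.hasMFDerivAt

section ActionField

variable {EG : Type*} [NormedAddCommGroup EG] [NormedSpace ℝ EG]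
  {G : Type*} [TopologicalSpace G] [ChartedSpace EG G] [Group G]
  {E : Type*} [NormedAddCommGroup E] [NormedSpace ℝ E]
  {M : Type*} [TopologicalSpace M] [ChartedSpace E M] [MulAction G M]
  [ContMDiffSMul 𝓘(ℝ, EG) 𝓘(ℝ, E) ∞ G M]

theorem contMDiff_smul_const (p : M) :
    ContMDiff 𝓘(ℝ, EG) 𝓘(ℝ, E) ∞ (fun a : G => a • p) :=
  contMDiff_id.smul contMDiff_const

theorem hasMFDerivAt_smul_const (p : M) :
    HasMFDerivAt 𝓘(ℝ, EG) 𝓘(ℝ, E) (fun a : G => a • p) 1 (actionField EG G (E := E) p) :=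
  ((contMDiff_smul_const p).mdifferentiable (by simp) 1).hasMFDerivAt

end ActionField

section Bundles

variable {EG : Type*} [NormedAddCommGroup EG] [NormedSpace ℝ EG]
  {G : Type*} [TopologicalSpace G] [ChartedSpace EG G] [Group G] [LieGroup 𝓘(ℝ, EG) ∞ G]
  {EP : Type*} [NormedAddCommGroup EP] [NormedSpace ℝ EP]
  {P : Type*} [TopologicalSpace P] [ChartedSpace EP P]
  [MulAction G P] [ContMDiffSMul 𝓘(ℝ, EG) 𝓘(ℝ, EP) ∞ G P]
  {EF : Type*} [NormedAddCommGroup EF] [NormedSpace ℝ EF]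
  {F : Type*} [TopologicalSpace F] [ChartedSpace EF F]
  [MulAction G F] [ContMDiffSMul 𝓘(ℝ, EG) 𝓘(ℝ, EF) ∞ G F]
  {EB : Type*} [NormedAddCommGroup EB] [NormedSpace ℝ EB]
  {B : Type*} [TopologicalSpace B] [ChartedSpace EB B]
  {EM : Type*} [NormedAddCommGroup EM] [NormedSpace ℝ EM]
  {M : Type*} [TopologicalSpace M] [ChartedSpace EM M]
  {ι : Type*} {proj : M → B} {A : BundleAtlas G EF F EB EM ι proj} {pr : P → B}
  (PB : PrincipalBundle EG EP A pr)

theorem BundleAtlas.contMDiffAt_proj (A : BundleAtlas G EF F EB EM ι proj) (m : M) :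
    ContMDiffAt 𝓘(ℝ, EM) 𝓘(ℝ, EB) ∞ proj m := by
  obtain ⟨i, hi⟩ := A.cover (proj m)
  have hm := (A.triv i).open_source.mem_nhds ((A.triv i).mem_source.2 hi)
  have h1 : ContMDiffAt 𝓘(ℝ, EM) 𝓘(ℝ, EB) ∞
      (fun q => ((A.triv i).toOpenPartialHomeomorph q).1) m :=
    ((A.contMDiffOn_triv i).contMDiffAt hm).fst
  refine h1.congr_of_eventuallyEq ?_
  filter_upwards [hm] with q hq
  exact ((A.triv i).coe_fst hq).symm

namespace PrincipalBundle

theorem mem_baseSet {i : ι} {b : B} : b ∈ (A.triv i).baseSet ↔ b ∈ (PB.triv i).baseSet := by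
  rw [PB.baseSet_eq]

/-- The formula for `π̄` in any local trivialization. -/
theorem assocProj_eq {i : ι} {p : P} (hi : pr p ∈ (PB.triv i).baseSet) (f : F) :
    assocProj PB (p, f) = (A.triv i).toOpenPartialHomeomorph.symm
      (pr p, ((PB.triv i).toOpenPartialHomeomorph p).2 • f) := by
  have hj : pr p ∈ (A.triv (A.cover (pr p)).choose).baseSet := (A.cover (pr p)).choose_spec
  have e : assocProj PB (p, f) =
    (A.triv (A.cover (pr p)).choose).toOpenPartialHomeomorph.symm
      (pr p, ((PB.triv (A.cover (pr p)).choose).toOpenPartialHomeomorph p).2 • f) := rfl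
  rw [e]
  -- The chosen index becomes an arbitrary `j`. The two bundles share the transition function from
  -- `j` to `i`, so changing the trivialization on both sides cancels.
  generalize (A.cover (pr p)).choose = j at hj
  have hj' := PB.mem_baseSet.1 hj
  have hi' := PB.mem_baseSet.2 hi
  have h1 := PB.triv_symm i j (pr p) ⟨hi, hj'⟩ ((PB.triv j).toOpenPartialHomeomorph p).2
  have h2 : (PB.triv j).toOpenPartialHomeomorph.symm
      (pr p, ((PB.triv j).toOpenPartialHomeomorph p).2) = p :=
    (PB.triv j).symm_apply_mk_proj ((PB.triv j).mem_source.2 hj')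
  rw [h2] at h1
  have h3 := A.triv_symm i j (pr p) ⟨hi', hj⟩
    (((PB.triv j).toOpenPartialHomeomorph p).2 • f)
  have h4 : ((PB.triv i).toOpenPartialHomeomorph p).2 =
      A.transition i j (pr p) * ((PB.triv j).toOpenPartialHomeomorph p).2 := congrArg Prod.snd h1
  rw [smul_smul, ← h4] at h3
  have hs : (A.triv j).toOpenPartialHomeomorph.symm
      (pr p, ((PB.triv j).toOpenPartialHomeomorph p).2 • f) ∈ (A.triv i).source := by
    rw [(A.triv i).mem_source, (A.triv j).proj_symm_apply' hj]
    exact hi'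
  rw [← h3]
  exact ((A.triv i).toOpenPartialHomeomorph.left_inv hs).symm

theorem exists_mem_baseSet (p : P) : ∃ i, pr p ∈ (PB.triv i).baseSet := by
  obtain ⟨i, hi⟩ := A.cover (pr p)
  exact ⟨i, PB.mem_baseSet.1 hi⟩

theorem proj_assocProj (x : P × F) : proj (assocProj PB x) = pr x.1 := by
  obtain ⟨i, hi⟩ := PB.exists_mem_baseSet x.1
  rw [show x = (x.1, x.2) from rfl, PB.assocProj_eq hi,
    (A.triv i).proj_symm_apply' (PB.mem_baseSet.2 hi)]

theorem assocProj_smul (r : G) (p : P) (f : F) :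
    assocProj PB (r • p, r • f) = assocProj PB (p, f) := by
  obtain ⟨i, hi⟩ := PB.exists_mem_baseSet p
  have hi' : pr (r • p) ∈ (PB.triv i).baseSet := by rwa [PB.proj_smul]
  rw [PB.assocProj_eq hi, PB.assocProj_eq hi', PB.triv_smul i r p hi, PB.proj_smul, smul_smul,
    inv_mul_cancel_right]

theorem contMDiffAt_triv {i : ι} {p : P} (hi : pr p ∈ (PB.triv i).baseSet) :
    ContMDiffAt 𝓘(ℝ, EP) (𝓘(ℝ, EB).prod 𝓘(ℝ, EG)) ∞ (PB.triv i).toOpenPartialHomeomorph p :=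
  (PB.contMDiffOn_triv i).contMDiffAt
    ((PB.triv i).open_source.mem_nhds ((PB.triv i).mem_source.2 hi))

theorem contMDiffAt_pr (PB : PrincipalBundle EG EP A pr) (p : P) :
    ContMDiffAt 𝓘(ℝ, EP) 𝓘(ℝ, EB) ∞ pr p := by
  obtain ⟨i, hi⟩ := PB.exists_mem_baseSet p
  have h1 : ContMDiffAt 𝓘(ℝ, EP) 𝓘(ℝ, EB) ∞
      (fun q => ((PB.triv i).toOpenPartialHomeomorph q).1) p := (PB.contMDiffAt_triv hi).fst
  refine h1.congr_of_eventuallyEq ?_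
  filter_upwards [(PB.triv i).open_source.mem_nhds ((PB.triv i).mem_source.2 hi)] with q hq
  exact ((PB.triv i).coe_fst hq).symm

/-- In a local trivialization, `q ↦ a` where `q` is `a • p` up to moving `q` along the base. -/
def vertCoord (i : ι) (p q : P) : G :=
  ((PB.triv i).toOpenPartialHomeomorph q).2⁻¹ * ((PB.triv i).toOpenPartialHomeomorph p).2

theorem vertCoord_smul {i : ι} {p : P} (hi : pr p ∈ (PB.triv i).baseSet) (r : G) :
    PB.vertCoord i p (r • p) = r := by
  rw [vertCoord, PB.triv_smul i r p hi]
  simp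

theorem vertCoord_self (i : ι) (p : P) : PB.vertCoord i p p = 1 := by
  rw [vertCoord, inv_mul_cancel]

theorem mdifferentiableAt_vertCoord {i : ι} {p : P} (hi : pr p ∈ (PB.triv i).baseSet) :
    MDifferentiableAt 𝓘(ℝ, EP) 𝓘(ℝ, EG) (PB.vertCoord i p) p := by
  have h1 : ContMDiffAt 𝓘(ℝ, EP) 𝓘(ℝ, EG) ∞
      (fun q => ((PB.triv i).toOpenPartialHomeomorph q).2) p := (PB.contMDiffAt_triv hi).snd
  have h2 : ContMDiffAt 𝓘(ℝ, EP) 𝓘(ℝ, EG) ∞ (PB.vertCoord i p) p := h1.inv.mul contMDiffAt_const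
  exact h2.mdifferentiableAt (by simp)

/-- The principal action is infinitesimally free. -/
theorem actionField_injective (PB : PrincipalBundle EG EP A pr) (p : P)
    (U : GroupLieAlgebra 𝓘(ℝ, EG) G)
    (hU : actionField EG G (E := EP) p U = 0) : U = 0 := by
  obtain ⟨i, hi⟩ := PB.exists_mem_baseSet p
  have h1 := ((PB.mdifferentiableAt_vertCoord hi).hasMFDerivAt_of_eq (one_smul G p)).comp 1
    (hasMFDerivAt_smul_const (EG := EG) (G := G) (E := EP) p)
  -- The orbit map has a differentiable left inverse, so its differential at `1` is injective.
  have h2 : PB.vertCoord i p ∘ (fun a : G => a • p) = id :=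
    funext fun r => PB.vertCoord_smul hi r
  rw [h2] at h1
  have h3 := hasMFDerivAt_unique h1 (hasMFDerivAt_id 1)
  let dL : EP →L[ℝ] EG := mfderiv 𝓘(ℝ, EP) 𝓘(ℝ, EG) (PB.vertCoord i p) p
  have h4 : dL (actionField EG G (E := EP) p U) = U :=
    congrArg (fun l : EG →L[ℝ] EG => l U) h3
  exact h4.symm.trans ((congrArg dL hU).trans (map_zero dL))

/-- Vectors tangent to the fibers of `pr` are tangent to the orbits. -/
theorem exists_actionField_eq (PB : PrincipalBundle EG EP A pr) (p : P)
    (Z : TangentSpace 𝓘(ℝ, EP) p)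
    (hZ : mfderiv 𝓘(ℝ, EP) 𝓘(ℝ, EB) pr p Z = 0) :
    ∃ U, actionField EG G (E := EP) p U = Z := by
  obtain ⟨i, hi⟩ := PB.exists_mem_baseSet p
  let a : G := ((PB.triv i).toOpenPartialHomeomorph p).2
  -- `Ψ` inverts `q ↦ (pr q, vertCoord q)` near `p`, and on the slice over `pr p` it is the orbit
  -- map. If `dpr Z = 0`, then `Z = dΨ(0, U) = U^∨` with `U` the derivative of `vertCoord` along
  -- `Z`.
  let Ψ : B × G → P := fun x => (PB.triv i).toOpenPartialHomeomorph.symm (x.1, a * x.2⁻¹)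
  have hmem : ((pr p, a * (1 : G)⁻¹) : B × G) ∈ (PB.triv i).target :=
    (PB.triv i).mem_target.2 hi
  have hΨ : MDifferentiableAt (𝓘(ℝ, EB).prod 𝓘(ℝ, EG)) 𝓘(ℝ, EP) Ψ (pr p, 1) := by
    have h1 : ContMDiffAt (𝓘(ℝ, EB).prod 𝓘(ℝ, EG)) (𝓘(ℝ, EB).prod 𝓘(ℝ, EG)) ∞
        (fun x : B × G => (x.1, a * x.2⁻¹)) (pr p, 1) :=
      contMDiffAt_fst.prodMk (contMDiffAt_const.mul contMDiffAt_snd.inv)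
    have h2 := ((PB.contMDiffOn_symm i).contMDiffAt ((PB.triv i).open_target.mem_nhds hmem))
    exact (h2.comp (pr p, (1 : G)) h1).mdifferentiableAt (by simp)
  have hpr : HasMFDerivAt 𝓘(ℝ, EP) 𝓘(ℝ, EB) pr p (mfderiv 𝓘(ℝ, EP) 𝓘(ℝ, EB) pr p) :=
    ((PB.contMDiffAt_pr p).mdifferentiableAt (by simp)).hasMFDerivAt
  have hL := (PB.mdifferentiableAt_vertCoord hi).hasMFDerivAt
  have hpair : (pr p, PB.vertCoord i p p) = (pr p, 1) := by rw [PB.vertCoord_self]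
  have h1 := (hΨ.hasMFDerivAt_of_eq hpair).comp p (hpr.prodMk hL)
  have hid : id =ᶠ[nhds p] Ψ ∘ fun q => (pr q, PB.vertCoord i p q) := by
    filter_upwards [(PB.triv i).open_source.mem_nhds ((PB.triv i).mem_source.2 hi)] with q hq
    have : a * (PB.vertCoord i p q)⁻¹ = ((PB.triv i).toOpenPartialHomeomorph q).2 := by
      simp [vertCoord, a]
    simp only [Function.comp_apply, id, Ψ, this]
    exact ((PB.triv i).symm_apply_mk_proj hq).symm
  have h2 := hasMFDerivAt_unique (h1.congr_of_eventuallyEq hid) (hasMFDerivAt_id p)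
  have h3 := hΨ.hasMFDerivAt.comp 1
    ((hasMFDerivAt_const (I := 𝓘(ℝ, EG)) (I' := 𝓘(ℝ, EB)) (pr p) (1 : G)).prodMk
      (hasMFDerivAt_id (I := 𝓘(ℝ, EG)) (1 : G)))
  have hact : Ψ ∘ Prod.mk (pr p) = fun r : G => r • p := by
    funext r
    have h4 := PB.triv_smul i r p hi
    have h5 : r • p ∈ (PB.triv i).source := by
      rw [(PB.triv i).mem_source, PB.proj_smul]; exact hi
    simp only [Function.comp_apply, Ψ, a, ← h4]
    exact (PB.triv i).toOpenPartialHomeomorph.left_inv h5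
  rw [hact] at h3
  have h4 := hasMFDerivAt_unique h3 (hasMFDerivAt_smul_const (EG := EG) (G := G) (E := EP) p)
  let D : EB × EG →L[ℝ] EP := mfderiv (𝓘(ℝ, EB).prod 𝓘(ℝ, EG)) 𝓘(ℝ, EP) Ψ (pr p, 1)
  let dL : EP →L[ℝ] EG := mfderiv 𝓘(ℝ, EP) 𝓘(ℝ, EG) (PB.vertCoord i p) p
  let dpr : EP →L[ℝ] EB := mfderiv 𝓘(ℝ, EP) 𝓘(ℝ, EB) pr p
  have e1 : ∀ Y : EP, D (dpr Y, dL Y) = Y := fun Y => congrArg (fun l : EP →L[ℝ] EP => l Y) h2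
  have e2 : ∀ U : EG, D (0, U) = actionField EG G (E := EP) p U := fun U =>
    congrArg (fun l : EG →L[ℝ] EP => l U) h4
  refine ⟨dL Z, (e2 _).symm.trans ?_⟩
  refine Eq.trans ?_ (e1 Z)
  rw [show dpr Z = 0 from hZ]

/-- Orbit directions of the diagonal action are in the kernel of `dπ̄`. -/
theorem mfderiv_assocProj_actionField
    (hsm : ContMDiff (𝓘(ℝ, EP).prod 𝓘(ℝ, EF)) 𝓘(ℝ, EM) ∞ (assocProj PB)) (p : P) (f : F)
    (U : GroupLieAlgebra 𝓘(ℝ, EG) G) :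
    mfderiv (𝓘(ℝ, EP).prod 𝓘(ℝ, EF)) 𝓘(ℝ, EM) (assocProj PB) (p, f)
      (tangentPair p f (actionField EG G p U) (actionField EG G f U)) = 0 := by
  have h1 := ((hsm.mdifferentiable (by simp) (p, f)).hasMFDerivAt_of_eq
    (x := ((1 : G) • p, (1 : G) • f)) (by rw [one_smul, one_smul])).comp 1
    ((hasMFDerivAt_smul_const (EG := EG) (G := G) (E := EP) p).prodMk
      (hasMFDerivAt_smul_const (EG := EG) (G := G) (E := EF) f))
  have h2 : assocProj PB ∘ (fun r : G => (r • p, r • f)) = fun _ => assocProj PB (p, f) :=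
    funext fun r => PB.assocProj_smul r p f
  rw [h2] at h1
  have h3 := hasMFDerivAt_unique h1 (hasMFDerivAt_const (I := 𝓘(ℝ, EG)) (I' := 𝓘(ℝ, EM))
    (assocProj PB (p, f)) (1 : G))
  exact congrArg (fun l : EG →L[ℝ] EM => l U) h3

/-- `π̄` restricts to an immersion on `{p} × F`. -/
theorem eq_zero_of_mfderiv_assocProj_right
    (hsm : ContMDiff (𝓘(ℝ, EP).prod 𝓘(ℝ, EF)) 𝓘(ℝ, EM) ∞ (assocProj PB)) (p : P) (f : F)
    (W : TangentSpace 𝓘(ℝ, EF) f)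
    (hW : mfderiv (𝓘(ℝ, EP).prod 𝓘(ℝ, EF)) 𝓘(ℝ, EM) (assocProj PB) (p, f)
      (tangentPair p f 0 W) = 0) : W = 0 := by
  obtain ⟨i, hi⟩ := PB.exists_mem_baseSet p
  have hi' := PB.mem_baseSet.2 hi
  let a : G := ((PB.triv i).toOpenPartialHomeomorph p).2
  -- `ρ` is a left inverse of `f' ↦ π̄(p, f')`, differentiable at `π̄(p, f)`.
  let ρ : M → F := fun m => a⁻¹ • ((A.triv i).toOpenPartialHomeomorph m).2
  have hval : ∀ f' : F, (A.triv i).toOpenPartialHomeomorph (assocProj PB (p, f')) =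
      (pr p, a • f') := by
    intro f'
    rw [PB.assocProj_eq hi]
    exact (A.triv i).apply_symm_apply' hi'
  have hsrc : assocProj PB (p, f) ∈ (A.triv i).source := by
    rw [(A.triv i).mem_source, PB.proj_assocProj]
    exact hi'
  have hρ : MDifferentiableAt 𝓘(ℝ, EM) 𝓘(ℝ, EF) ρ (assocProj PB (p, f)) := by
    have h1 : ContMDiffAt 𝓘(ℝ, EM) 𝓘(ℝ, EF) ∞
        (fun m => ((A.triv i).toOpenPartialHomeomorph m).2) (assocProj PB (p, f)) :=
      ((A.contMDiffOn_triv i).contMDiffAt ((A.triv i).open_source.mem_nhds hsrc)).snd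
    have h2 : ContMDiffAt 𝓘(ℝ, EM) 𝓘(ℝ, EF) ∞ ρ (assocProj PB (p, f)) :=
      (contMDiffAt_const (I := 𝓘(ℝ, EM)) (I' := 𝓘(ℝ, EG)) (c := a⁻¹)).smul h1
    exact h2.mdifferentiableAt (by simp)
  have h1 := hρ.hasMFDerivAt.comp f ((hsm.mdifferentiable (by simp) (p, f)).hasMFDerivAt.comp f
    ((hasMFDerivAt_const (I := 𝓘(ℝ, EF)) (I' := 𝓘(ℝ, EP)) p f).prodMk
      (hasMFDerivAt_id (I := 𝓘(ℝ, EF)) f)))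
  have h2 : ρ ∘ (assocProj PB ∘ Prod.mk p) = id := by
    funext f'
    simp only [Function.comp_apply, ρ, hval, inv_smul_smul, id]
  have h3 : HasMFDerivAt 𝓘(ℝ, EF) 𝓘(ℝ, EF) (ρ ∘ (assocProj PB ∘ Prod.mk p)) f _ := h1
  rw [h2] at h3
  have h4 := hasMFDerivAt_unique h3 (hasMFDerivAt_id f)
  let dρ : EM →L[ℝ] EF := mfderiv 𝓘(ℝ, EM) 𝓘(ℝ, EF) ρ (assocProj PB (p, f))
  let dπ : EP × EF →L[ℝ] EM :=
    mfderiv (𝓘(ℝ, EP).prod 𝓘(ℝ, EF)) 𝓘(ℝ, EM) (assocProj PB) (p, f)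
  have h5 : dρ (dπ (0, W)) = W := congrArg (fun l : EF →L[ℝ] EF => l W) h4
  have h6 : dπ (0, W) = 0 := hW
  exact h5.symm.trans ((congrArg dρ h6).trans (map_zero dρ))

/-- The kernel of `dπ̄` consists of the orbit directions of the diagonal action. -/
theorem exists_actionField_of_mfderiv_assocProj
    (hsm : ContMDiff (𝓘(ℝ, EP).prod 𝓘(ℝ, EF)) 𝓘(ℝ, EM) ∞ (assocProj PB)) (p : P) (f : F)
    (Z : TangentSpace 𝓘(ℝ, EP) p) (W : TangentSpace 𝓘(ℝ, EF) f)
    (h : mfderiv (𝓘(ℝ, EP).prod 𝓘(ℝ, EF)) 𝓘(ℝ, EM) (assocProj PB) (p, f)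
      (tangentPair p f Z W) = 0) :
    ∃ U, actionField EG G p U = Z ∧ actionField EG G f U = W := by
  let dπ : EP × EF →L[ℝ] EM :=
    mfderiv (𝓘(ℝ, EP).prod 𝓘(ℝ, EF)) 𝓘(ℝ, EM) (assocProj PB) (p, f)
  -- Differentiate `proj ∘ π̄ = pr ∘ fst`: the `P`-component of a kernel vector is vertical for
  -- `pr`, hence tangent to the orbit.
  have hpr : mfderiv 𝓘(ℝ, EP) 𝓘(ℝ, EB) pr p Z = 0 := by
    have h1 := ((A.contMDiffAt_proj (assocProj PB (p, f))).mdifferentiableAt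
      (by simp)).hasMFDerivAt.comp (p, f) (hsm.mdifferentiable (by simp) (p, f)).hasMFDerivAt
    have h2 : proj ∘ assocProj PB = pr ∘ Prod.fst := funext fun x => PB.proj_assocProj x
    rw [h2] at h1
    have h3 := ((PB.contMDiffAt_pr p).mdifferentiableAt (by simp)).hasMFDerivAt.comp
      ((p, f) : P × F) (hasMFDerivAt_fst (I := 𝓘(ℝ, EP)) (I' := 𝓘(ℝ, EF)) (p, f))
    have h4 := hasMFDerivAt_unique h3 h1
    let dproj : EM →L[ℝ] EB := mfderiv 𝓘(ℝ, EM) 𝓘(ℝ, EB) proj (assocProj PB (p, f))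
    have h5 : mfderiv 𝓘(ℝ, EP) 𝓘(ℝ, EB) pr p Z = dproj (dπ (Z, W)) :=
      congrArg (fun l : EP × EF →L[ℝ] EB => l (Z, W)) h4
    have h6 : dπ (Z, W) = 0 := h
    exact h5.trans ((congrArg dproj h6).trans (map_zero dproj))
  obtain ⟨U, hU⟩ := PB.exists_actionField_eq p Z hpr
  refine ⟨U, hU, ?_⟩
  let us : EF := actionField EG G (E := EF) f U
  let w : EF := W
  let z : EP := Z
  have h0 : dπ (z, us) = 0 := by
    have := PB.mfderiv_assocProj_actionField hsm p f U
    rw [hU] at this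
    exact this
  -- Removing the diagonal orbit vector leaves a kernel vector tangent to `{p} × F`, where `π̄` is
  -- an immersion.
  have h1 : dπ (0, w - us) = 0 := by
    have e : ((0, w - us) : EP × EF) = (z, w) - (z, us) := by simp
    rw [e, map_sub, h0, sub_zero]
    exact h
  have h2 : w - us = 0 := PB.eq_zero_of_mfderiv_assocProj_right hsm p f (w - us) h1
  exact (sub_eq_zero.1 h2).symm

end PrincipalBundle

end Bundles

/-! ## Linear algebra at a point of `P × F` -/

/-- The tangent data of `π̄ : P × F → M` at a point: `J` and `K` are the action field maps on `P`
and `F`, `dpr` is the differential of `π̄`, and `q`, `b`, `bt`, `c` are the values of `Q`, `g`, `g_t`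
and `g_F`. -/
structure TangentModel (𝔤 V W T : Type*)
    [NormedAddCommGroup 𝔤] [NormedSpace ℝ 𝔤] [NormedAddCommGroup V] [NormedSpace ℝ V]
    [NormedAddCommGroup W] [NormedSpace ℝ W] [NormedAddCommGroup T] [NormedSpace ℝ T] where
  J : 𝔤 →L[ℝ] V
  K : 𝔤 →L[ℝ] W
  dpr : V × W →L[ℝ] T
  q : 𝔤 →L[ℝ] 𝔤 →L[ℝ] ℝ
  b : V →L[ℝ] V →L[ℝ] ℝ
  bt : V →L[ℝ] V →L[ℝ] ℝ
  c : W →L[ℝ] W →L[ℝ] ℝ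
  q_pos : ∀ v, v ≠ 0 → 0 < q v v
  b_symm : ∀ u v, b u v = b v u
  b_pos : ∀ v, v ≠ 0 → 0 < b v v
  bt_symm : ∀ u v, bt u v = bt v u
  bt_pos : ∀ v, v ≠ 0 → 0 < bt v v
  c_pos : ∀ v, v ≠ 0 → 0 < c v v
  J_injective : ∀ U, J U = 0 → U = 0
  dpr_surjective : Function.Surjective dpr
  dpr_orbit : ∀ U, dpr (J U, K U) = 0
  dpr_kernel : ∀ x w, dpr (x, w) = 0 → ∃ U, J U = x ∧ K U = w
  bt_orbit : ∀ X, (∀ U, b X (J U) = 0) → ∀ U, bt X (J U) = 0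
  bt_normal : ∀ X, (∀ U, b X (J U) = 0) → ∀ Y, (∀ U, b Y (J U) = 0) → bt X Y = b X Y

namespace TangentModel

variable {𝔤 V W T : Type*}
  [NormedAddCommGroup 𝔤] [NormedSpace ℝ 𝔤] [FiniteDimensional ℝ 𝔤]
  [NormedAddCommGroup V] [NormedSpace ℝ V] [FiniteDimensional ℝ V]
  [NormedAddCommGroup W] [NormedSpace ℝ W] [FiniteDimensional ℝ W]
  [NormedAddCommGroup T] [NormedSpace ℝ T] [FiniteDimensional ℝ T]
  (D : TangentModel 𝔤 V W T)

/-- The orbit tensor `P`. -/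
def P : 𝔤 →L[ℝ] 𝔤 := D.q.inverse ∘L pullbackForm D.b D.J

/-- The orbit tensor `P_t`. -/
def Pt : 𝔤 →L[ℝ] 𝔤 := D.q.inverse ∘L pullbackForm D.bt D.J

/-- The orbit tensor `P_F`. -/
def PF : 𝔤 →L[ℝ] 𝔤 := D.q.inverse ∘L pullbackForm D.c D.K

/-- The tensor `1 + P_t⁻¹ P_F`. -/
def S : 𝔤 →L[ℝ] 𝔤 := ContinuousLinearMap.id ℝ _ + D.Pt.inverse ∘L D.PF

/-- The tensor `C̃_t` on `𝔤`. -/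
def tC : 𝔤 →L[ℝ] 𝔤 := -(D.P.inverse ∘L (D.PF ∘L D.S.inverse))

/-- The metric tensor of `g_t` relative to `g`. -/
def Ct : V →L[ℝ] V := D.b.inverse ∘L D.bt

/-- The vectors in `V` normal to the orbit. -/
def normalV : Submodule ℝ V where
  carrier := {X | ∀ U, D.b X (D.J U) = 0}
  add_mem' {X Y} hX hY U := by rw [map_add, _root_.add_apply, hX U, hY U, add_zero]
  zero_mem' U := by rw [map_zero, _root_.zero_apply]
  smul_mem' a X hX U := by rw [map_smul, _root_.smul_apply, hX U, smul_zero]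

/-- The vectors in `W` normal to the orbit. -/
def normalW : Submodule ℝ W where
  carrier := {X | ∀ U, D.c X (D.K U) = 0}
  add_mem' {X Y} hX hY U := by rw [map_add, _root_.add_apply, hX U, hY U, add_zero]
  zero_mem' U := by rw [map_zero, _root_.zero_apply]
  smul_mem' a X hX U := by rw [map_smul, _root_.smul_apply, hX U, smul_zero]

/-- The complement `𝔪` of the isotropy algebra. -/
def m : Submodule ℝ 𝔤 where
  carrier := {A | ∀ U, D.K U = 0 → D.q A U = 0}
  add_mem' {A B} hA hB U hU := by rw [map_add, _root_.add_apply, hA U hU, hB U hU, add_zero]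
  zero_mem' U _ := by rw [map_zero, _root_.zero_apply]
  smul_mem' a A hA U hU := by rw [map_smul, _root_.smul_apply, hA U hU, smul_zero]

/-! ### Orbit tensors and `C̃_t` on the Lie algebra -/

theorem q_P (U A : 𝔤) : D.q (D.P U) A = D.b (D.J U) (D.J A) :=
  congrArg (fun l : 𝔤 →L[ℝ] ℝ => l A)
    ((isInvertible_of_pos D.q_pos).self_apply_inverse (pullbackForm D.b D.J U))

theorem q_Pt (U A : 𝔤) : D.q (D.Pt U) A = D.bt (D.J U) (D.J A) :=
  congrArg (fun l : 𝔤 →L[ℝ] ℝ => l A)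
    ((isInvertible_of_pos D.q_pos).self_apply_inverse (pullbackForm D.bt D.J U))

theorem q_PF (U A : 𝔤) : D.q (D.PF U) A = D.c (D.K U) (D.K A) :=
  congrArg (fun l : 𝔤 →L[ℝ] ℝ => l A)
    ((isInvertible_of_pos D.q_pos).self_apply_inverse (pullbackForm D.c D.K U))

theorem eq_zero_of_form_self {E : Type*} [NormedAddCommGroup E] [NormedSpace ℝ E]
    {b : E →L[ℝ] E →L[ℝ] ℝ} (hb : ∀ v, v ≠ 0 → 0 < b v v) {v : E} (h : b v v = 0) : v = 0 := by
  by_contra hv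
  exact (hb v hv).ne' h

theorem isInvertible_P : D.P.IsInvertible :=
  isInvertible_of_injective_of_finrank_eq _ (fun U hU => by
    refine D.J_injective U (eq_zero_of_form_self D.b_pos ?_)
    rw [← D.q_P, hU, map_zero, _root_.zero_apply]) rfl

theorem isInvertible_Pt : D.Pt.IsInvertible :=
  isInvertible_of_injective_of_finrank_eq _ (fun U hU => by
    refine D.J_injective U (eq_zero_of_form_self D.bt_pos ?_)
    rw [← D.q_Pt, hU, map_zero, _root_.zero_apply]) rfl

theorem K_eq_zero_of_PF {U : 𝔤} (hU : D.PF U = 0) : D.K U = 0 := by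
  refine eq_zero_of_form_self D.c_pos ?_
  rw [← D.q_PF, hU, map_zero, _root_.zero_apply]

theorem PF_eq_zero {U : 𝔤} (hU : D.K U = 0) : D.PF U = 0 := by
  refine eq_of_form_eq D.q_pos fun A => ?_
  rw [D.q_PF, hU, map_zero, map_zero]
  rfl

theorem PF_mem (U : 𝔤) : D.PF U ∈ D.m := fun A hA => by
  rw [D.q_PF, hA, map_zero]

theorem eq_zero_of_mem_m {U : 𝔤} (hm : U ∈ D.m) (hU : D.K U = 0) : U = 0 :=
  eq_zero_of_form_self D.q_pos (hm U hU)

/-- Testing `P U ∈ 𝔪` against `U` itself gives `g(U^∨, U^∨) = 0`. This is what makes the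
normalization `P U ∈ 𝔪` select a unique representative modulo isotropy. -/
theorem eq_zero_of_P_mem_m {U : 𝔤} (hm : D.P U ∈ D.m) (hU : D.K U = 0) : U = 0 := by
  have := hm U hU
  rw [D.q_P] at this
  exact D.J_injective U (eq_zero_of_form_self D.b_pos this)

theorem S_apply (U : 𝔤) : D.S U = U + D.Pt.inverse (D.PF U) := rfl

/-- `P_t S = P_t + P_F` is positive definite for `Q`: the first summand is, since the action on `P`
is infinitesimally free, and the second is nonnegative. -/
theorem isInvertible_S : D.S.IsInvertible :=
  isInvertible_of_injective_of_finrank_eq _ (fun U hU => by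
    have h1 : D.Pt U + D.PF U = 0 := by
      have := congrArg D.Pt hU
      rwa [D.S_apply, map_add, map_zero, D.isInvertible_Pt.self_apply_inverse] at this
    have h2 : D.bt (D.J U) (D.J U) + D.c (D.K U) (D.K U) = 0 := by
      rw [← D.q_Pt, ← D.q_PF, ← _root_.add_apply, ← map_add, h1, map_zero, _root_.zero_apply]
    have h3 : 0 ≤ D.c (D.K U) (D.K U) := by
      by_cases h : D.K U = 0
      · simp [h]
      · exact (D.c_pos _ h).le
    by_contra hne
    have h4 := D.bt_pos (D.J U) fun h => hne (D.J_injective U h)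
    linarith) rfl

theorem S_inverse_of_isotropy {U : 𝔤} (hU : D.K U = 0) : D.S.inverse U = U := by
  rw [D.isInvertible_S.inverse_apply_eq, D.S_apply, D.PF_eq_zero hU, map_zero, add_zero]

theorem tC_apply (U : 𝔤) : D.tC U = -D.P.inverse (D.PF (D.S.inverse U)) := rfl

theorem tC_of_isotropy {U : 𝔤} (hU : D.K U = 0) : D.tC U = 0 := by
  rw [D.tC_apply, D.S_inverse_of_isotropy hU, D.PF_eq_zero hU, map_zero, neg_zero]

theorem tC_S (U : 𝔤) : D.tC (D.S U) = -D.P.inverse (D.PF U) := by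
  rw [D.tC_apply, D.isInvertible_S.inverse_apply_self]

theorem P_tC_mem (U : 𝔤) : D.P (D.tC U) ∈ D.m := by
  rw [D.tC_apply, map_neg, D.isInvertible_P.self_apply_inverse]
  exact D.m.neg_mem (D.PF_mem _)

/-- If `P_F` kills `S⁻¹ U`, then `S` fixes `S⁻¹ U`, so `U = S⁻¹ U` lies in the isotropy algebra. -/
theorem K_eq_zero_of_tC {U : 𝔤} (hU : D.tC U = 0) : D.K U = 0 := by
  have h1 : D.PF (D.S.inverse U) = 0 := by
    rw [D.tC_apply, neg_eq_zero] at hU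
    rw [← D.isInvertible_P.self_apply_inverse (D.PF (D.S.inverse U)), hU, map_zero]
  have h2 := D.isInvertible_S.self_apply_inverse U
  rw [D.S_apply, h1, map_zero, add_zero] at h2
  rw [← h2]
  exact D.K_eq_zero_of_PF h1

/-- `P_F` maps `𝔪` onto `𝔪`. -/
theorem exists_PF_eq {A : 𝔤} (hA : A ∈ D.m) : ∃ U ∈ D.m, D.PF U = A := by
  let L : D.m →ₗ[ℝ] D.m := (D.PF : 𝔤 →ₗ[ℝ] 𝔤).restrict fun U _ => D.PF_mem U
  have hL : Function.Injective L := by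
    rw [← LinearMap.ker_eq_bot, LinearMap.ker_eq_bot']
    rintro ⟨U, hU⟩ h
    have h1 : D.PF U = 0 := congrArg Subtype.val h
    exact Subtype.ext (D.eq_zero_of_mem_m hU (D.K_eq_zero_of_PF h1))
  obtain ⟨⟨U, hU⟩, h⟩ := LinearMap.injective_iff_surjective.1 hL ⟨A, hA⟩
  exact ⟨U, hU, congrArg Subtype.val h⟩

theorem exists_isotropy_sub_mem_m (U : 𝔤) : ∃ Z, D.K Z = 0 ∧ U - Z ∈ D.m := by
  obtain ⟨⟨Z, hZ⟩, h⟩ := exists_sub_orthogonal_range D.q_pos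
    (LinearMap.ker (D.K : 𝔤 →ₗ[ℝ] W)).subtype U
  exact ⟨Z, hZ, fun A hA => h ⟨A, hA⟩⟩

theorem exists_isotropy_P_sub_mem_m (U : 𝔤) : ∃ Z, D.K Z = 0 ∧ D.P (U - Z) ∈ D.m := by
  -- `P (U - Z) ∈ 𝔪` says that `U - Z` is orthogonal to the isotropy algebra for the form `g(U^∨,
  -- V^∨)`, so the projection is taken with respect to that form instead of `Q`.
  obtain ⟨⟨Z, hZ⟩, h⟩ := exists_sub_orthogonal_range (b := pullbackForm D.b D.J)
    (fun v hv => D.b_pos _ fun h0 => hv (D.J_injective v h0))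
    (LinearMap.ker (D.K : 𝔤 →ₗ[ℝ] W)).subtype U
  exact ⟨Z, hZ, fun A hA => (D.q_P _ _).trans (h ⟨A, hA⟩)⟩

/-! ### The decomposition `X + X_F + U^*` and the extension of `C̃_t` -/

theorem exists_normalV (v : V) : ∃ X ∈ D.normalV, ∃ U, v = X + D.J U := by
  obtain ⟨U, hU⟩ := exists_sub_orthogonal_range D.b_pos (D.J : 𝔤 →ₗ[ℝ] V) v
  exact ⟨v - D.J U, hU, U, (sub_add_cancel _ _).symm⟩

theorem exists_normalW (w : W) : ∃ X ∈ D.normalW, ∃ U, w = X + D.K U := by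
  obtain ⟨U, hU⟩ := exists_sub_orthogonal_range D.c_pos (D.K : 𝔤 →ₗ[ℝ] W) w
  exact ⟨w - D.K U, hU, U, (sub_add_cancel _ _).symm⟩

/-- The vector `X + X_F + U^*` of `T`. -/
def vec (X : V) (XF : W) (U : 𝔤) : T := D.dpr (X, XF + D.K U)

theorem vec_sub (X Y : V) (XF YF : W) (U A : 𝔤) :
    D.vec X XF U - D.vec Y YF A = D.vec (X - Y) (XF - YF) (U - A) := by
  simp only [vec]
  rw [← map_sub, Prod.mk_sub_mk, map_sub]
  congr 2
  abel

theorem vec_sub_isotropy (X : V) (XF : W) (U : 𝔤) {Z : 𝔤} (hZ : D.K Z = 0) :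
    D.vec X XF (U - Z) = D.vec X XF U := by
  simp only [vec, map_sub, hZ, sub_zero]

theorem exists_vec (ξ : T) : ∃ X ∈ D.normalV, ∃ XF ∈ D.normalW, ∃ U, D.vec X XF U = ξ := by
  obtain ⟨⟨v, w⟩, rfl⟩ := D.dpr_surjective ξ
  obtain ⟨X, hX, A, rfl⟩ := D.exists_normalV v
  -- Modulo the kernel vector `(A^∨, A^*)`, the orbit part of `v` moves to the second factor with
  -- the opposite sign.
  obtain ⟨XF, hXF, U, hU⟩ := D.exists_normalW (w - D.K A)
  refine ⟨X, hX, XF, hXF, U, ?_⟩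
  have e : ((X + D.J A, w) : V × W) = (X, XF + D.K U) + (D.J A, D.K A) := by
    rw [← hU]; simp
  rw [e, map_add, D.dpr_orbit, add_zero, vec]

/-- A kernel vector is `(A^∨, A^*)`. Its first component is both normal and tangent to the orbit, so
`A = 0`; then `X_F = -U^*` is also both normal and tangent. Only `U^*` is determined to vanish,
which is why `U` needs a normalization. -/
theorem eq_zero_of_vec {X : V} (hX : X ∈ D.normalV) {XF : W} (hXF : XF ∈ D.normalW) {U : 𝔤}
    (h : D.vec X XF U = 0) : X = 0 ∧ XF = 0 ∧ D.K U = 0 := by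
  obtain ⟨A, hA, hA'⟩ := D.dpr_kernel _ _ h
  have h1 : X = 0 := by
    refine eq_zero_of_form_self D.b_pos ?_
    nth_rewrite 2 [← hA]
    exact hX A
  have h2 : A = 0 := D.J_injective A (hA.trans h1)
  rw [h2, map_zero] at hA'
  have h3 : XF = 0 := by
    refine eq_zero_of_form_self D.c_pos ?_
    have e : XF = D.K (-U) := by rw [map_neg]; exact eq_neg_of_add_eq_zero_left hA'.symm
    nth_rewrite 2 [e]
    exact hXF _
  refine ⟨h1, h3, ?_⟩
  rw [h3, zero_add] at hA'
  exact hA'.symm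

theorem existsUnique_vec (ξ : T) : ∃! x : V × W × 𝔤, x.1 ∈ D.normalV ∧ x.2.1 ∈ D.normalW ∧
    D.P x.2.2 ∈ D.m ∧ D.vec x.1 x.2.1 x.2.2 = ξ := by
  obtain ⟨X, hX, XF, hXF, U, hU⟩ := D.exists_vec ξ
  obtain ⟨Z, hZ, hZm⟩ := D.exists_isotropy_P_sub_mem_m U
  refine ⟨(X, XF, U - Z), ⟨hX, hXF, hZm, (D.vec_sub_isotropy X XF U hZ).trans hU⟩, ?_⟩
  rintro ⟨Y, YF, A⟩ ⟨hY, hYF, hA, h⟩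
  have h0 : D.vec (Y - X) (YF - XF) (A - (U - Z)) = 0 := by
    rw [← D.vec_sub, D.vec_sub_isotropy X XF U hZ, hU]
    exact sub_eq_zero.2 h
  obtain ⟨h1, h2, h3⟩ := D.eq_zero_of_vec (D.normalV.sub_mem hY hX) (D.normalW.sub_mem hYF hXF) h0
  have h4 : A - (U - Z) = 0 :=
    D.eq_zero_of_P_mem_m (by rw [map_sub]; exact D.m.sub_mem hA hZm) h3
  exact Prod.ext (sub_eq_zero.1 h1) (Prod.ext (sub_eq_zero.1 h2) (sub_eq_zero.1 h4))

/-- The map `(X, X_F, U) ↦ X + X_F + (L U)^*` for `U ∈ 𝔪`. -/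
def vecMap (L : 𝔤 →L[ℝ] 𝔤) : (D.normalV × D.normalW × D.m) →ₗ[ℝ] T where
  toFun x := D.vec x.1 x.2.1 (L x.2.2)
  map_add' x y := by
    simp only [vec]
    rw [← map_add]
    congr 1
    refine Prod.ext rfl ?_
    simp only [Prod.fst_add, Prod.snd_add, Submodule.coe_add, map_add]
    abel
  map_smul' a x := by
    simp only [vec, RingHom.id_apply]
    rw [← map_smul]
    congr 1
    refine Prod.ext rfl ?_
    simp only [Prod.smul_fst, Prod.smul_snd, Submodule.coe_smul, map_smul, Prod.smul_mk, smul_add]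

theorem vecMap_injective {L : 𝔤 →L[ℝ] 𝔤} (hL : ∀ U ∈ D.m, D.K (L U) = 0 → U = 0) :
    Function.Injective (D.vecMap L) := by
  rw [← LinearMap.ker_eq_bot, LinearMap.ker_eq_bot']
  rintro ⟨⟨X, hX⟩, ⟨XF, hXF⟩, ⟨U, hU⟩⟩ h
  obtain ⟨h1, h2, h3⟩ := D.eq_zero_of_vec hX hXF h
  exact Prod.ext (Subtype.ext h1) (Prod.ext (Subtype.ext h2) (Subtype.ext (hL U hU h3)))

/-- The parametrization of `T` by `(X, X_F, U)` with `U ∈ 𝔪`. -/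
def vecEquiv : (D.normalV × D.normalW × D.m) ≃ₗ[ℝ] T :=
  LinearEquiv.ofBijective (D.vecMap (ContinuousLinearMap.id ℝ 𝔤))
    ⟨D.vecMap_injective fun U hU h => D.eq_zero_of_mem_m hU h, fun ξ => by
      obtain ⟨X, hX, XF, hXF, U, hU⟩ := D.exists_vec ξ
      obtain ⟨Z, hZ, hZm⟩ := D.exists_isotropy_sub_mem_m U
      exact ⟨(⟨X, hX⟩, ⟨XF, hXF⟩, ⟨U - Z, hZm⟩), (D.vec_sub_isotropy X XF U hZ).trans hU⟩⟩

/-- `C̃_t` takes values in `P⁻¹ 𝔪`, which meets the isotropy algebra only in zero, and its own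
kernel is contained in the isotropy algebra. -/
theorem tC_injective_on_m {U : 𝔤} (hU : U ∈ D.m) (h : D.K (D.tC U) = 0) : U = 0 :=
  D.eq_zero_of_mem_m hU (D.K_eq_zero_of_tC (D.eq_zero_of_P_mem_m (D.P_tC_mem U) h))

/-- `C` extends `C̃_t` to `T`. -/
def IsExtension (C : T ≃ₗ[ℝ] T) : Prop :=
  ∀ X ∈ D.normalV, ∀ XF ∈ D.normalW, ∀ U ∈ D.m, C (D.vec X XF U) = D.vec X XF (D.tC U)

theorem existsUnique_isExtension : ∃! C, D.IsExtension C := by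
  -- The extension is read in the coordinates with `U ∈ 𝔪`; an injective endomorphism of the
  -- finite-dimensional `T` is an automorphism.
  have hinj : Function.Injective ((D.vecMap D.tC).comp (D.vecEquiv.symm : T →ₗ[ℝ] _)) :=
    (D.vecMap_injective fun U hU h => D.tC_injective_on_m hU h).comp D.vecEquiv.symm.injective
  refine ⟨LinearEquiv.ofInjectiveEndo _ hinj, ?_, ?_⟩
  · intro X hX XF hXF U hU
    have h1 : D.vec X XF U = D.vecEquiv (⟨X, hX⟩, ⟨XF, hXF⟩, ⟨U, hU⟩) := rfl
    rw [LinearEquiv.coe_ofInjectiveEndo, LinearMap.comp_apply, h1]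
    simp only [LinearEquiv.coe_coe, LinearEquiv.symm_apply_apply]
    rfl
  · intro C hC
    ext ξ
    obtain ⟨⟨⟨X, hX⟩, ⟨XF, hXF⟩, ⟨U, hU⟩⟩, rfl⟩ := D.vecEquiv.surjective ξ
    have h1 : D.vecEquiv (⟨X, hX⟩, ⟨XF, hXF⟩, ⟨U, hU⟩) = D.vec X XF U := rfl
    rw [LinearEquiv.coe_ofInjectiveEndo, LinearMap.comp_apply, LinearEquiv.coe_coe,
      LinearEquiv.symm_apply_apply, h1, hC X hX XF hXF U hU]
    rfl

/-! ### The metric tensor `C_t` and horizontal lifts -/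

theorem bt_eq {X : V} (hX : X ∈ D.normalV) (U : 𝔤) :
    D.bt (X + D.J (D.Pt.inverse (D.P U))) = D.b (X + D.J U) := by
  ext v
  -- Both forms are block diagonal for the splitting into normal and orbit directions. They agree on
  -- the normal block, and on the orbit block both sides are `Q(P U, A)`.
  obtain ⟨Y, hY, A, rfl⟩ := D.exists_normalV v
  have h1 := D.bt_orbit X hX A
  have h2 := D.bt_orbit Y hY (D.Pt.inverse (D.P U))
  have h3 := D.bt_normal X hX Y hY
  have h4 := hX A
  have h5 := hY U
  have h6 : D.bt (D.J (D.Pt.inverse (D.P U))) (D.J A) = D.b (D.J U) (D.J A) := by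
    rw [← D.q_Pt, D.isInvertible_Pt.self_apply_inverse, D.q_P]
  rw [D.bt_symm] at h2
  rw [D.b_symm] at h5
  simp only [map_add, _root_.add_apply, h1, h2, h3, h4, h5, h6]

theorem isInvertible_Ct : D.Ct.IsInvertible :=
  (isInvertible_of_pos D.b_pos).inverse.comp (isInvertible_of_pos D.bt_pos)

theorem Ct_inverse {X : V} (hX : X ∈ D.normalV) (U : 𝔤) :
    D.Ct.inverse (X + D.J U) = X + D.J (D.Pt.inverse (D.P U)) := by
  rw [D.isInvertible_Ct.inverse_apply_eq]
  have : D.Ct (X + D.J (D.Pt.inverse (D.P U))) =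
    D.b.inverse (D.bt (X + D.J (D.Pt.inverse (D.P U)))) := rfl
  rw [this, D.bt_eq hX, (isInvertible_of_pos D.b_pos).inverse_apply_self]

/-- The horizontal lift of `C̃_t⁻¹ (X + X_F + U^*)`. -/
theorem isExtension_symm_vec {C : T ≃ₗ[ℝ] T} (hC : D.IsExtension C) {X : V} (hX : X ∈ D.normalV)
    {XF : W} (hXF : XF ∈ D.normalW) {U A : 𝔤} (hA : D.PF A = D.P U) :
    C.symm (D.vec X XF U) = D.dpr (D.Ct.inverse (X + D.J U), XF - D.K A) := by
  rw [LinearEquiv.symm_apply_eq, D.Ct_inverse hX]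
  -- The defining property of `C` applies only to arguments in `𝔪`, where `-S A` need not lie. Its
  -- isotropy part `Z` is harmless: both `Z^*` and `C̃_t Z` vanish.
  obtain ⟨Z, hZ, hZm⟩ := D.exists_isotropy_sub_mem_m (-D.S A)
  have hS : D.S A = A + D.Pt.inverse (D.P U) := by rw [D.S_apply, hA]
  have h1 : D.dpr (X + D.J (D.Pt.inverse (D.P U)), XF - D.K A) = D.vec X XF (-D.S A - Z) := by
    rw [D.vec_sub_isotropy X XF _ hZ, vec]
    have e : ((X + D.J (D.Pt.inverse (D.P U)), XF - D.K A) : V × W) =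
        (X, XF + D.K (-D.S A)) +
          (D.J (D.Pt.inverse (D.P U)), D.K (D.Pt.inverse (D.P U))) := by
      refine Prod.ext rfl ?_
      simp only [hS, map_neg, map_add, Prod.snd_add]
      abel
    rw [e, map_add, D.dpr_orbit, add_zero]
  rw [h1, hC X hX XF hXF _ hZm, map_sub, D.tC_of_isotropy hZ, sub_zero, map_neg, D.tC_S, neg_neg,
    hA, D.isInvertible_P.inverse_apply_self]

/-- The first term reduces to `g(X + U^∨, B^∨) = Q(P U, B)`, the second to `-Q(P_F A, B)`. -/
theorem horizontal {X : V} (hX : X ∈ D.normalV) {XF : W} (hXF : XF ∈ D.normalW) {U A : 𝔤}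
    (hA : D.PF A = D.P U) (B : 𝔤) :
    D.bt (D.Ct.inverse (X + D.J U)) (D.J B) + D.c (XF - D.K A) (D.K B) = 0 := by
  rw [D.Ct_inverse hX, D.bt_eq hX, map_add, map_sub, _root_.add_apply, _root_.sub_apply, hX B,
    hXF B, ← D.q_PF, hA, D.q_P]
  ring

end TangentModel

/-! ## Cheeger deformations and vectors normal to the orbits -/

section Cheeger

/-- If `(x, A) ↦ x + J A` is a Riemannian submersion from `(V × 𝔤, b + s q)` to `(V, bt)`, then
the `b`-orthogonal complement of the range of `J` is unchanged by passing from `b` to `bt`. -/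
theorem form_eq_of_isometry_add {𝔤 V : Type*} [NormedAddCommGroup 𝔤] [NormedSpace ℝ 𝔤]
    [FiniteDimensional ℝ 𝔤] [NormedAddCommGroup V] [NormedSpace ℝ V]
    {J : 𝔤 →L[ℝ] V} {q : 𝔤 →L[ℝ] 𝔤 →L[ℝ] ℝ} {b bt : V →L[ℝ] V →L[ℝ] ℝ} {s : ℝ} (hs : 0 < s)
    (hq : ∀ v, v ≠ 0 → 0 < q v v) (hb : ∀ v, v ≠ 0 → 0 < b v v)
    (hiso : ∀ (x y : V) (A B : 𝔤), (∀ U, b x (J U) = s * q A U) → (∀ U, b y (J U) = s * q B U) →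
      bt (x + J A) (y + J B) = b x y + s * q A B)
    {X : V} (hX : ∀ U, b X (J U) = 0) :
    (∀ U, bt X (J U) = 0) ∧ ∀ Y, (∀ U, b Y (J U) = 0) → bt X Y = b X Y := by
  have hX' : ∀ U, b X (J U) = s * q 0 U := fun U => by simp [hX U]
  refine ⟨fun U => ?_, fun Y hY => ?_⟩
  · have hpos : ∀ v, v ≠ 0 → 0 < (pullbackForm b J + s • q) v v := by
      intro v hv
      have h1 : 0 ≤ b (J v) (J v) := by
        by_cases h : J v = 0
        · simp [h]
        · exact (hb _ h).le
      exact add_pos_of_nonneg_of_pos h1 (mul_pos hs (hq v hv))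
    -- This `A` makes `(J A, U - A)` the horizontal lift of `J U`. Its pairing with the horizontal
    -- vector `(X, 0)` is `b X (J A) = 0`.
    obtain ⟨A, hA⟩ := (isInvertible_of_pos hpos).surjective (s • q U)
    have hA' : ∀ W, b (J A) (J W) = s * q (U - A) W := by
      intro W
      have h1 : b (J A) (J W) + s * q A W = s * q U W :=
        congrArg (fun l : 𝔤 →L[ℝ] ℝ => l W) hA
      rw [map_sub, _root_.sub_apply]
      linarith
    have := hiso X (J A) 0 (U - A) hX' hA'
    rw [hX] at this
    simpa using this
  · simpa using hiso X Y 0 0 hX' fun U => by simp [hY U]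

variable {EG : Type*} [NormedAddCommGroup EG] [NormedSpace ℝ EG]
  {G : Type*} [TopologicalSpace G] [ChartedSpace EG G] [Group G] [LieGroup 𝓘(ℝ, EG) ∞ G]
  {E : Type*} [NormedAddCommGroup E] [NormedSpace ℝ E]
  {M : Type*} [TopologicalSpace M] [ChartedSpace E M] [IsManifold 𝓘(ℝ, E) ∞ M] [MulAction G M]
  [ContMDiffSMul 𝓘(ℝ, EG) 𝓘(ℝ, E) ∞ G M]

/-- The differential at `(p, 1)` of the action map is `(Z, U) ↦ Z + U^*`. -/
theorem mfderiv_smul_one (p : M) (Z : TangentSpace 𝓘(ℝ, E) p) (U : GroupLieAlgebra 𝓘(ℝ, EG) G) :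
    @Eq E (mfderiv (𝓘(ℝ, E).prod 𝓘(ℝ, EG)) 𝓘(ℝ, E) (fun x : M × G => x.2 • x.1) (p, 1)
      (tangentPair p (1 : G) Z U)) (Z + actionField EG G p U) := by
  have hsm : ContMDiff (𝓘(ℝ, E).prod 𝓘(ℝ, EG)) 𝓘(ℝ, E) ∞ (fun x : M × G => x.2 • x.1) :=
    contMDiff_snd.smul contMDiff_fst
  have hd := (hsm.mdifferentiable (by simp) (p, 1)).hasMFDerivAt
  have h1 := hd.comp p ((hasMFDerivAt_id (I := 𝓘(ℝ, E)) p).prodMk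
    (hasMFDerivAt_const (I := 𝓘(ℝ, E)) (I' := 𝓘(ℝ, EG)) (1 : G) p))
  have e1 : (fun x : M × G => x.2 • x.1) ∘ (fun q : M => (id q, (1 : G))) = id :=
    funext fun q => one_smul G q
  have h1' : HasMFDerivAt 𝓘(ℝ, E) 𝓘(ℝ, E)
    ((fun x : M × G => x.2 • x.1) ∘ (fun q : M => (id q, (1 : G)))) p _ := h1
  rw [e1] at h1'
  have h2 := hasMFDerivAt_unique h1' (hasMFDerivAt_id p)
  have h3 := hd.comp 1 ((hasMFDerivAt_const (I := 𝓘(ℝ, EG)) (I' := 𝓘(ℝ, E)) p (1 : G)).prodMk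
    (hasMFDerivAt_id (I := 𝓘(ℝ, EG)) (1 : G)))
  have h4 := hasMFDerivAt_unique h3 (hasMFDerivAt_smul_const (EG := EG) (G := G) (E := E) p)
  let D : E × EG →L[ℝ] E :=
    mfderiv (𝓘(ℝ, E).prod 𝓘(ℝ, EG)) 𝓘(ℝ, E) (fun x : M × G => x.2 • x.1) (p, 1)
  have e2 : D (Z, 0) = Z := congrArg (fun l : E →L[ℝ] E => l Z) h2
  have e3 : D (0, U) = actionField EG G (E := E) p U := congrArg (fun l : EG →L[ℝ] E => l U) h4
  have e4 : ∀ (z : E) (u : EG), D (z, u) = D (z, 0) + D (0, u) := fun z u => by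
    rw [← map_add, Prod.mk_add_mk, add_zero, zero_add]
  exact (e4 Z U).trans (congrArg₂ (· + ·) e2 e3)

variable [FiniteDimensional ℝ EG]

/-- For `t > 0` this is the linear statement `form_eq_of_isometry_add` at `(p, 1)`, where the action
map has differential `(Z, U) ↦ Z + U^*`. These two properties are all that is used of a Cheeger
deformation. -/
theorem IsCheegerDeformation.inner_normal {Q : SmoothMetric EG G} {g gt : SmoothMetric E M} {t : ℝ}
    (hgt : IsCheegerDeformation Q g t gt) (p : M) {X : TangentSpace 𝓘(ℝ, E) p}
    (hX : X ∈ orbitNormal EG G g p) :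
    (∀ U, gt.inner p X (actionField EG G p U) = 0) ∧
      ∀ Y ∈ orbitNormal EG G g p, gt.inner p X Y = g.inner p X Y := by
  rcases hgt with ⟨-, rfl⟩ | ⟨ht, H⟩
  · exact ⟨hX, fun _ _ => rfl⟩
  -- The submersion computes the metric at `1 • p`, which has to be moved to `p`.
  have hinner : ∀ (p' : M) (a b : E), p' = p →
      gt.inner p' (a : TangentSpace 𝓘(ℝ, E) p') (b : TangentSpace 𝓘(ℝ, E) p') =
        gt.inner p (a : TangentSpace 𝓘(ℝ, E) p) (b : TangentSpace 𝓘(ℝ, E) p) := by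
    rintro p' a b rfl; rfl
  let J : EG →L[ℝ] E := actionField EG G (E := E) p
  let b : E →L[ℝ] E →L[ℝ] ℝ := g.inner p
  let bt : E →L[ℝ] E →L[ℝ] ℝ := gt.inner p
  let q : EG →L[ℝ] EG →L[ℝ] ℝ := Q.inner 1
  have hhor : ∀ (x : E) (A : EG), (∀ U, b x (J U) = 1 / t * q A U) →
      ∀ w, mfderiv (𝓘(ℝ, E).prod 𝓘(ℝ, EG)) 𝓘(ℝ, E) (fun x : M × G => x.2 • x.1) (p, 1) w = 0 →
        prodInner g (1 / t) Q (p, 1) (tangentPair p (1 : G) x A) w = 0 := by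
    intro x A hxA w hw
    obtain ⟨w₁, w₂⟩ : E × EG := w
    have h0 : w₁ + J w₂ = 0 := (mfderiv_smul_one (EG := EG) p w₁ w₂).symm.trans hw
    have h1 : w₁ = -J w₂ := eq_neg_of_add_eq_zero_left h0
    change b x w₁ + 1 / t * q A w₂ = 0
    rw [h1, map_neg, hxA]
    ring
  refine form_eq_of_isometry_add (𝔤 := EG) (V := E) (J := J) (q := q) (b := b) (bt := bt)
    (one_div_pos.2 ht) (Q.pos 1) (g.pos p) (fun x y A B hA hB => ?_) hX
  have h1 := H.isometry (p, 1) (tangentPair p (1 : G) x A) (tangentPair p (1 : G) y B)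
    (hhor x A hA) (hhor y B hB)
  have h2 := hinner ((1 : G) • p) (x + J A) (y + J B) (one_smul G p)
  refine h2.symm.trans (Eq.trans ?_ h1)
  exact congrArg₂ (fun a b : E => gt.inner ((1 : G) • p) a b)
    (mfderiv_smul_one (EG := EG) p x A).symm (mfderiv_smul_one (EG := EG) p y B).symm

end Cheeger

/-! ## The curvature of the deformed metric -/

section Main

variable {EG : Type*} [NormedAddCommGroup EG] [NormedSpace ℝ EG] [FiniteDimensional ℝ EG]
  {G : Type*} [TopologicalSpace G] [ChartedSpace EG G] [Group G] [LieGroup 𝓘(ℝ, EG) ∞ G]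
  {EP : Type*} [NormedAddCommGroup EP] [NormedSpace ℝ EP]
  {P : Type*} [TopologicalSpace P] [ChartedSpace EP P] [IsManifold 𝓘(ℝ, EP) ∞ P]
  [MulAction G P] [ContMDiffSMul 𝓘(ℝ, EG) 𝓘(ℝ, EP) ∞ G P]
  {EF : Type*} [NormedAddCommGroup EF] [NormedSpace ℝ EF]
  {F : Type*} [TopologicalSpace F] [ChartedSpace EF F] [IsManifold 𝓘(ℝ, EF) ∞ F]
  [MulAction G F] [ContMDiffSMul 𝓘(ℝ, EG) 𝓘(ℝ, EF) ∞ G F]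
  {EB : Type*} [NormedAddCommGroup EB] [NormedSpace ℝ EB]
  {B : Type*} [TopologicalSpace B] [ChartedSpace EB B]
  {EM : Type*} [NormedAddCommGroup EM] [NormedSpace ℝ EM]
  {M : Type*} [TopologicalSpace M] [ChartedSpace EM M] [IsManifold 𝓘(ℝ, EM) ∞ M]
  {ι : Type*} {proj : M → B} {A : BundleAtlas G EF F EB EM ι proj} {pr : P → B}
  {PB : PrincipalBundle EG EP A pr} {Q : SmoothMetric EG G} {g gt : SmoothMetric EP P}
  {gF : SmoothMetric EF F} {ht : SmoothMetric EM M} {t : ℝ}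

/-- The tangent data of `π̄` at `(p, f)`. -/
def tangentModel (hgt : IsCheegerDeformation Q g t gt)
    (hht : IsRiemannianSubmersion (prodInner gt 1 gF) ht (assocProj PB)) (p : P) (f : F) :
    TangentModel EG EP EF EM where
  J := actionField EG G (E := EP) p
  K := actionField EG G (E := EF) f
  dpr := mfderiv (𝓘(ℝ, EP).prod 𝓘(ℝ, EF)) 𝓘(ℝ, EM) (assocProj PB) (p, f)
  q := Q.inner 1
  b := g.inner p
  bt := gt.inner p
  c := gF.inner f
  q_pos := Q.pos 1
  b_symm := g.symm p
  b_pos := g.pos p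
  bt_symm := gt.symm p
  bt_pos := gt.pos p
  c_pos := gF.pos f
  J_injective := PB.actionField_injective p
  dpr_surjective := hht.surjective_mfderiv (p, f)
  dpr_orbit := PB.mfderiv_assocProj_actionField hht.contMDiff p f
  dpr_kernel := PB.exists_actionField_of_mfderiv_assocProj hht.contMDiff p f
  bt_orbit := fun _ hX => (hgt.inner_normal p hX).1
  bt_normal := fun _ hX => (hgt.inner_normal p hX).2

variable [FiniteDimensional ℝ EP] [FiniteDimensional ℝ EF] [FiniteDimensional ℝ EM]

theorem orbitTensor_orbitTensorInv (hgt : IsCheegerDeformation Q g t gt)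
    (hht : IsRiemannianSubmersion (prodInner gt 1 gF) ht (assocProj PB)) (p : P) (f : F)
    {U : GroupLieAlgebra 𝓘(ℝ, EG) G} (hU : U ∈ isotropyCompl (E := EF) Q f) :
    orbitTensor Q gF f (orbitTensorInv Q gF f U) = U :=
  Function.invFunOn_eq ((tangentModel hgt hht p f).exists_PF_eq hU)

/-- O'Neill's inequality for `π̄` at the horizontal lifts of `C̃_t⁻¹ (X + X_F + U^*)` and
`C̃_t⁻¹ (Y + Y_F + V^*)`. -/
theorem kappa_add_sec_le (hgt : IsCheegerDeformation Q g t gt)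
    (hht : IsRiemannianSubmersion (prodInner gt 1 gF) ht (assocProj PB)) (p : P) (f : F)
    {C : TangentSpace 𝓘(ℝ, EM) (assocProj PB (p, f)) ≃ₗ[ℝ]
      TangentSpace 𝓘(ℝ, EM) (assocProj PB (p, f))}
    (hC : IsTildeCExtension Q g gt gF PB p f C)
    {X Y : TangentSpace 𝓘(ℝ, EP) p} (hX : X ∈ orbitNormal EG G g p)
    (hY : Y ∈ orbitNormal EG G g p)
    {XF YF : TangentSpace 𝓘(ℝ, EF) f} (hXF : XF ∈ orbitNormal EG G gF f)
    (hYF : YF ∈ orbitNormal EG G gF f) {U V : GroupLieAlgebra 𝓘(ℝ, EG) G}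
    (hU : orbitTensor Q g p U ∈ isotropyCompl (E := EF) Q f)
    (hV : orbitTensor Q g p V ∈ isotropyCompl (E := EF) Q f) :
    kappa g gt p (X + actionField EG G p U) (Y + actionField EG G p V)
      + sec gF f (XF - actionField EG G f (orbitTensorInv Q gF f (orbitTensor Q g p U)))
        (YF - actionField EG G f (orbitTensorInv Q gF f (orbitTensor Q g p V))) ≤
      sec ht (assocProj PB (p, f)) (C.symm (baseVec PB p f X XF U))
        (C.symm (baseVec PB p f Y YF V)) := by
  let D := tangentModel hgt hht p f
  have hor : ∀ {X : TangentSpace 𝓘(ℝ, EP) p}, X ∈ orbitNormal EG G g p →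
      ∀ {XF : TangentSpace 𝓘(ℝ, EF) f}, XF ∈ orbitNormal EG G gF f →
      ∀ {U : GroupLieAlgebra 𝓘(ℝ, EG) G}, orbitTensor Q g p U ∈ isotropyCompl (E := EF) Q f →
      ∀ w, mfderiv (𝓘(ℝ, EP).prod 𝓘(ℝ, EF)) 𝓘(ℝ, EM) (assocProj PB) (p, f) w = 0 →
        prodInner gt 1 gF (p, f) (tangentPair p f
          ((metricTensor g gt p).inverse (X + actionField EG G p U))
          (XF - actionField EG G f (orbitTensorInv Q gF f (orbitTensor Q g p U)))) w = 0 := by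
    intro X hX XF hXF U hU w hw
    obtain ⟨w₁, w₂⟩ : EP × EF := w
    obtain ⟨A, hA₁, hA₂⟩ := D.dpr_kernel w₁ w₂ hw
    simp only [prodInner, one_mul]
    rw [← hA₁, ← hA₂]
    exact D.horizontal hX hXF (orbitTensor_orbitTensorInv hgt hht p f hU) A
  have hsymm : ∀ {X : TangentSpace 𝓘(ℝ, EP) p}, X ∈ orbitNormal EG G g p →
      ∀ {XF : TangentSpace 𝓘(ℝ, EF) f}, XF ∈ orbitNormal EG G gF f →
      ∀ {U : GroupLieAlgebra 𝓘(ℝ, EG) G}, orbitTensor Q g p U ∈ isotropyCompl (E := EF) Q f →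
      C.symm (baseVec PB p f X XF U) =
        mfderiv (𝓘(ℝ, EP).prod 𝓘(ℝ, EF)) 𝓘(ℝ, EM) (assocProj PB) (p, f) (tangentPair p f
          ((metricTensor g gt p).inverse (X + actionField EG G p U))
          (XF - actionField EG G f (orbitTensorInv Q gF f (orbitTensor Q g p U)))) :=
    fun hX _ hXF _ hU =>
      D.isExtension_symm_vec (C := C) hC hX hXF (orbitTensor_orbitTensorInv hgt hht p f hU)
  rw [hsymm hX hXF hU, hsymm hY hYF hV]
  exact hht.sec_add_sec_le p f _ _ _ _ (hor hX hXF hU) (hor hY hYF hV)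

end Main

end CheegerBundle

end

/-! ### The curvature formula -/

open CheegerBundle in
theorem mainTheorem2
    {EG : Type*} [NormedAddCommGroup EG] [NormedSpace ℝ EG] [FiniteDimensional ℝ EG]
    {G : Type*} [TopologicalSpace G] [ChartedSpace EG G] [Group G] [LieGroup 𝓘(ℝ, EG) ∞ G]
    [CompactSpace G]
    {EP : Type*} [NormedAddCommGroup EP] [NormedSpace ℝ EP] [FiniteDimensional ℝ EP]
    {P : Type*} [TopologicalSpace P] [ChartedSpace EP P] [IsManifold 𝓘(ℝ, EP) ∞ P]
    [MulAction G P] [ContMDiffSMul 𝓘(ℝ, EG) 𝓘(ℝ, EP) ∞ G P]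
    {EF : Type*} [NormedAddCommGroup EF] [NormedSpace ℝ EF] [FiniteDimensional ℝ EF]
    {F : Type*} [TopologicalSpace F] [ChartedSpace EF F] [IsManifold 𝓘(ℝ, EF) ∞ F]
    [MulAction G F] [ContMDiffSMul 𝓘(ℝ, EG) 𝓘(ℝ, EF) ∞ G F]
    {EB : Type*} [NormedAddCommGroup EB] [NormedSpace ℝ EB] [FiniteDimensional ℝ EB]
    {B : Type*} [TopologicalSpace B] [ChartedSpace EB B] [IsManifold 𝓘(ℝ, EB) ∞ B]
    {EM : Type*} [NormedAddCommGroup EM] [NormedSpace ℝ EM] [FiniteDimensional ℝ EM]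
    {M : Type*} [TopologicalSpace M] [ChartedSpace EM M] [IsManifold 𝓘(ℝ, EM) ∞ M]
    [CompactSpace M]
    -- the fiber bundle, its principal bundle and a biinvariant metric on the structure group
    {ι : Type*} {proj : M → B} (A : BundleAtlas G EF F EB EM ι proj)
    {pr : P → B} (PB : PrincipalBundle EG EP A pr)
    (Q : SmoothMetric EG G) (hQ : IsBiinvariant Q)
    -- the admissible metric `h`
    (g : SmoothMetric EP P) (hg : IsInvariant G g)
    (gF : SmoothMetric EF F) (hgF : IsInvariant G gF)
    (h : SmoothMetric EM M) (hh : IsRiemannianSubmersion (prodInner g 1 gF) h (assocProj PB))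
    -- its deformation `ht`
    (t : ℝ) (ht_nonneg : 0 ≤ t)
    (gt : SmoothMetric EP P) (hgt : IsCheegerDeformation Q g t gt)
    (ht : SmoothMetric EM M) (hht : IsRiemannianSubmersion (prodInner gt 1 gF) ht (assocProj PB))
    (p : P) (f : F) :
    -- every tangent vector is uniquely of the form `X + X_F + U^*` with `P U ∈ 𝔪_f`
    (∀ ξ : TangentSpace 𝓘(ℝ, EM) (assocProj PB (p, f)),
      ∃! x : TangentSpace 𝓘(ℝ, EP) p × TangentSpace 𝓘(ℝ, EF) f × GroupLieAlgebra 𝓘(ℝ, EG) G,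
        x.1 ∈ orbitNormal EG G g p ∧ x.2.1 ∈ orbitNormal EG G gF f ∧
        orbitTensor Q g p x.2.2 ∈ isotropyCompl (E := EF) Q f ∧
        baseVec PB p f x.1 x.2.1 x.2.2 = ξ) ∧
    -- `C̃_t` has a unique extension to the tangent space of `M`, and the extension is invertible
    (∃! C, IsTildeCExtension Q g gt gF PB p f C) ∧
    -- the curvature formula
    ∀ C, IsTildeCExtension Q g gt gF PB p f C →
      ∃ z : TangentSpace 𝓘(ℝ, EM) (assocProj PB (p, f)) →
          TangentSpace 𝓘(ℝ, EM) (assocProj PB (p, f)) → ℝ,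
        (∀ ξ η, 0 ≤ z ξ η) ∧
        ∀ X ∈ orbitNormal EG G g p, ∀ Y ∈ orbitNormal EG G g p,
        ∀ XF ∈ orbitNormal EG G gF f, ∀ YF ∈ orbitNormal EG G gF f,
        ∀ U V : GroupLieAlgebra 𝓘(ℝ, EG) G,
        orbitTensor Q g p U ∈ isotropyCompl (E := EF) Q f →
        orbitTensor Q g p V ∈ isotropyCompl (E := EF) Q f →
          riemann ht (assocProj PB (p, f))
              (C.symm (baseVec PB p f X XF U)) (C.symm (baseVec PB p f Y YF V))
              (C.symm (baseVec PB p f Y YF V)) (C.symm (baseVec PB p f X XF U)) =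
            kappa g gt p (X + actionField EG G p U) (Y + actionField EG G p V)
            + sec gF f (XF - actionField EG G f (orbitTensorInv Q gF f (orbitTensor Q g p U)))
                (YF - actionField EG G f (orbitTensorInv Q gF f (orbitTensor Q g p V)))
            + z (baseVec PB p f X XF U) (baseVec PB p f Y YF V) := by

  have hvec : ∀ ξ : TangentSpace 𝓘(ℝ, EM) (assocProj PB (p, f)),
      ∃! x : TangentSpace 𝓘(ℝ, EP) p × TangentSpace 𝓘(ℝ, EF) f × GroupLieAlgebra 𝓘(ℝ, EG) G,
        x.1 ∈ orbitNormal EG G g p ∧ x.2.1 ∈ orbitNormal EG G gF f ∧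
        orbitTensor Q g p x.2.2 ∈ isotropyCompl (E := EF) Q f ∧
        baseVec PB p f x.1 x.2.1 x.2.2 = ξ :=
    (tangentModel hgt hht p f).existsUnique_vec
  refine ⟨hvec, (tangentModel hgt hht p f).existsUnique_isExtension, fun C hC => ?_⟩
  -- Choosing the unique decomposition of each tangent vector lets the error term be defined on all
  -- of the tangent space, not merely on decomposed vectors.
  choose x hx hx' using hvec
  let L : TangentSpace 𝓘(ℝ, EM) (assocProj PB (p, f)) → TangentSpace 𝓘(ℝ, EP) p :=
    fun ξ => (x ξ).1 + actionField EG G p (x ξ).2.2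
  let LF : TangentSpace 𝓘(ℝ, EM) (assocProj PB (p, f)) → TangentSpace 𝓘(ℝ, EF) f :=
    fun ξ => (x ξ).2.1 -
      actionField EG G f (orbitTensorInv Q gF f (orbitTensor Q g p (x ξ).2.2))
  -- The error term is the defect in O'Neill's inequality, so its sign is `kappa_add_sec_le` and the
  -- formula holds by construction.
  refine ⟨fun ξ η => sec ht (assocProj PB (p, f)) (C.symm ξ) (C.symm η) -
    (kappa g gt p (L ξ) (L η) + sec gF f (LF ξ) (LF η)), fun ξ η => sub_nonneg.2 ?_, ?_⟩
  · obtain ⟨h1, h2, h3, h4⟩ := hx ξ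
    obtain ⟨k1, k2, k3, k4⟩ := hx η
    have := kappa_add_sec_le hgt hht p f hC h1 k1 h2 k2 h3 k3
    rw [h4, k4] at this
    exact this
  · intro X hX Y hY XF hXF YF hYF U V hU hV
    -- Uniqueness of the decomposition recovers the given components from the vector.
    have e1 : x (baseVec PB p f X XF U) = (X, XF, U) :=
      (hx' (baseVec PB p f X XF U) (X, XF, U) ⟨hX, hXF, hU, rfl⟩).symm
    have e2 : x (baseVec PB p f Y YF V) = (Y, YF, V) :=
      (hx' (baseVec PB p f Y YF V) (Y, YF, V) ⟨hY, hYF, hV, rfl⟩).symm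
    simp only [L, LF, e1, e2]
    exact (add_sub_cancel _ _).symm
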